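/- Let $G$ be a $3$-dimensional Lie group whose structure constants satisfy $\gamma_{ik}^{k}=0$ (class A). Class A vacuum initial data $(G,g,k)$ consist of a left invariant Riemannian metric $g$ and a left invariant symmetric covariant two-tensor $k$ on $G$ with $R_g-k_{ij}k^{ij}+(\mathrm{tr}_g k)^2=0$ and $\nabla_i\mathrm{tr}_g k-\nabla^jk_{ij}=0$. A canonical basis is a left invariant frame $\{e_i\}$ that is orthonormal for $g$, diagonalizes $k=\mathrm{diag}(k_1,k_2,k_3)$, and satisfies $[e_1,e_2]=n_3e_3$, $[e_2,e_3]=n_1e_1$, $[e_3,e_1]=n_2e_2$, where the signs of $(n_1,n_2,n_3)$ are one of $(0,0,0)$, $(+,0,0)$, $(0,+,-)$, $(0,+,+)$, $(-,+,+)$, $(+,+,+)$ (Bianchi types I, II, VI$_0$, VII$_0$, VIII, IX). The data are NUT initial data if there is a canonical basis of type VIII with $k_2=k_3$ and $n_2=n_3$; such a basis is said to be of NUT type. The class A development of the data is the Lorentz metric $$\bar g=-dt^2+\sum_{i=1}^3a_i(t)^2\,\xi^i\otimes\xi^i\quad\text{on } I\times G,\qquad a_i>0,$$ with $\xi^i$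 dual to a canonical basis, that satisfies $\mathrm{Ric}[\bar g]=0$ and induces the metric $g$ and the second fundamental form $k$ (with the convention $k(X,Y)=\bar g(\bar\nabla_XY,\partial_t)$) on $\{0\}\times G$, where $I\ni 0$ is the maximal open interval of existence. **Theorem.** Consider NUT initial data. The class A development exists, and it can be written in the above form with $\xi^i$ the duals of a canonical basis of NUT type. Moreover $\mathrm{tr}_g k\neq 0$. Choose the time orientation so that $\{0\}\times G$ is expanding, i.e. replace $t$ by $-t$ (and $k$ by $-k$) if $\mathrm{tr}_g k>0$, so that $\mathrm{tr}_gk<0$. Then $[0,\infty)\subseteq I$, and there are positive constants $\alpha_1$, $\alpha_2$ and $T$ such that for $t\ge T$ $$a_1(t)=\alpha_1+O(t^{-1}),\qquad a_2(t)=a_3(t)=\alpha_2t\left[1+O\!\left(\frac{\ln t}{t}\right)\right].$$ -/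

import Mathlib

open scoped Manifold ContDiff

noncomputable section

/-! ### Semi-Riemannian geometry in a homogeneous frame

A frame `E` of vector fields with constant structure constants, `[E α, E β] = ∑ γ, C α β γ • E γ`,
is considered, together with a metric whose components `g t α β = ⟨E α, E β⟩` depend only on a real
function `t` with `E α (t) = d α` constant, so that `E α (f ∘ t) = d α * f'(t)`. For the left
invariant frames of a Lie group `d = 0` and `g` is constant. -/

section Frame

variable {ι : Type} [Fintype ι] [DecidableEq ι]

/-- The Koszul formula for `⟨∇_{E α} E β, E γ⟩`, where `∇` is the Levi-Civita connection. -/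
def frameKoszul (C : ι → ι → ι → ℝ) (d : ι → ℝ) (g : ℝ → Matrix ι ι ℝ) (α β γ : ι) (t : ℝ) : ℝ :=
  (d α * deriv (fun s => g s β γ) t + d β * deriv (fun s => g s α γ) t
    - d γ * deriv (fun s => g s α β) t
    + ∑ δ, (C α β δ * g t δ γ - C α γ δ * g t δ β - C β γ δ * g t δ α)) / 2

/-- The connection coefficients: `∇_{E α} E β = ∑ γ, frameConnection C d g α β γ • E γ`. -/
def frameConnection (C : ι → ι → ι → ℝ) (d : ι → ℝ) (g : ℝ → Matrix ι ι ℝ) (α β γ : ι) (t : ℝ) :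
    ℝ :=
  ∑ δ, frameKoszul C d g α β δ t * (g t)⁻¹ δ γ

/-- The component along `E μ` of
`R(E α, E β) E γ = ∇_{E α} ∇_{E β} E γ - ∇_{E β} ∇_{E α} E γ - ∇_{[E α, E β]} E γ`. -/
def frameCurvature (C : ι → ι → ι → ℝ) (d : ι → ℝ) (g : ℝ → Matrix ι ι ℝ) (α β γ μ : ι) (t : ℝ) :
    ℝ :=
  d α * deriv (fun s => frameConnection C d g β γ μ s) t
    - d β * deriv (fun s => frameConnection C d g α γ μ s) t
    + ∑ δ, (frameConnection C d g β γ δ t * frameConnection C d g α δ μ t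
      - frameConnection C d g α γ δ t * frameConnection C d g β δ μ t
      - C α β δ * frameConnection C d g δ γ μ t)

/-- `Ric(E β, E γ)`, the trace of `X ↦ R(X, E β) E γ`. -/
def frameRicci (C : ι → ι → ι → ℝ) (d : ι → ℝ) (g : ℝ → Matrix ι ι ℝ) (β γ : ι) (t : ℝ) : ℝ :=
  ∑ α, frameCurvature C d g α β γ α t

end Frame

variable {𝔤 : Type*} [LieRing 𝔤] [LieAlgebra ℝ 𝔤]

/-- The structure constants of a basis of a Lie algebra: `[e i, e j] = ∑ k, γ i j k • e k`. -/
def structureConstants (e : Module.Basis (Fin 3) ℝ 𝔤) (i j k : Fin 3) : ℝ :=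
  e.repr ⁅e i, e j⁆ k

/-! ### Left invariant tensors on a three dimensional Lie group

Left invariant vector fields are identified with elements of the Lie algebra `𝔤`, and left invariant
covariant two-tensors with bilinear forms on `𝔤`. -/

/-- The matrix of components of a bilinear form in a basis. -/
def components (e : Module.Basis (Fin 3) ℝ 𝔤) (B : 𝔤 →ₗ[ℝ] 𝔤 →ₗ[ℝ] ℝ) : Matrix (Fin 3) (Fin 3) ℝ :=
  Matrix.of fun i j => B (e i) (e j)

/-- The connection coefficients of a left invariant metric `g`. -/
def leftConnection (e : Module.Basis (Fin 3) ℝ 𝔤) (g : 𝔤 →ₗ[ℝ] 𝔤 →ₗ[ℝ] ℝ) (i j k : Fin 3) : ℝ :=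
  frameConnection (structureConstants e) 0 (fun _ => components e g) i j k 0

/-- The scalar curvature `R_g = g^{ij} Ric_{ij}` of a left invariant metric `g`. -/
def leftScalarCurvature (e : Module.Basis (Fin 3) ℝ 𝔤) (g : 𝔤 →ₗ[ℝ] 𝔤 →ₗ[ℝ] ℝ) : ℝ :=
  ∑ i, ∑ j, (components e g)⁻¹ i j *
    frameRicci (structureConstants e) 0 (fun _ => components e g) i j 0

/-- `tr_g k = g^{ij} k_{ij}`. -/
def metricTrace (e : Module.Basis (Fin 3) ℝ 𝔤) (g k : 𝔤 →ₗ[ℝ] 𝔤 →ₗ[ℝ] ℝ) : ℝ :=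
  ∑ i, ∑ j, (components e g)⁻¹ i j * k (e i) (e j)

/-- `k_{ij} k^{ij} = g^{il} g^{jm} k_{ij} k_{lm}`. -/
def metricNormSq (e : Module.Basis (Fin 3) ℝ 𝔤) (g k : 𝔤 →ₗ[ℝ] 𝔤 →ₗ[ℝ] ℝ) : ℝ :=
  ∑ i, ∑ j, ∑ l, ∑ m, (components e g)⁻¹ i l * (components e g)⁻¹ j m *
    k (e i) (e j) * k (e l) (e m)

/-- `∇_l k_{ij} = e_l (k_{ij}) - k(∇_{e_l} e_i, e_j) - k(e_i, ∇_{e_l} e_j)`, where the first term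
vanishes by left invariance. -/
def covariantDerivative (e : Module.Basis (Fin 3) ℝ 𝔤) (g k : 𝔤 →ₗ[ℝ] 𝔤 →ₗ[ℝ] ℝ)
    (l i j : Fin 3) : ℝ :=
  -∑ m, (leftConnection e g l i m * k (e m) (e j) + leftConnection e g l j m * k (e i) (e m))

/-- `∇^j k_{ij} = g^{jl} ∇_l k_{ij}`. -/
def divergence (e : Module.Basis (Fin 3) ℝ 𝔤) (g k : 𝔤 →ₗ[ℝ] 𝔤 →ₗ[ℝ] ℝ) (i : Fin 3) : ℝ :=
  ∑ j, ∑ l, (components e g)⁻¹ j l * covariantDerivative e g k l i j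

variable (𝔤) in
/-- Class A vacuum initial data `(g, k)` on a Lie group with Lie algebra `𝔤`. -/
structure ClassAData where
  /-- The left invariant metric. -/
  g : 𝔤 →ₗ[ℝ] 𝔤 →ₗ[ℝ] ℝ
  /-- The left invariant symmetric covariant two-tensor. -/
  k : 𝔤 →ₗ[ℝ] 𝔤 →ₗ[ℝ] ℝ
  g_symm : ∀ X Y, g X Y = g Y X
  g_pos : ∀ X, X ≠ 0 → 0 < g X X
  k_symm : ∀ X Y, k X Y = k Y X
  /-- Class A: `γ_{ik}^k = 0`. -/
  classA : ∀ (e : Module.Basis (Fin 3) ℝ 𝔤) (i : Fin 3), ∑ k, structureConstants e i k k = 0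
  /-- `R_g - k_{ij} k^{ij} + (tr_g k)^2 = 0`. -/
  hamiltonian : ∀ e : Module.Basis (Fin 3) ℝ 𝔤,
    leftScalarCurvature e g - metricNormSq e g k + metricTrace e g k ^ 2 = 0
  /-- `∇_i tr_g k - ∇^j k_{ij} = 0`, where `tr_g k` is constant on the group by left invariance, so
  that the first term vanishes. -/
  momentum : ∀ (e : Module.Basis (Fin 3) ℝ 𝔤) (i : Fin 3), 0 - divergence e g k i = 0

/-- The Bianchi types of class A. -/
inductive BianchiType
  | I | II | VI₀ | VII₀ | VIII | IX

/-- The signs of `n₁, n₂, n₃` for each Bianchi type. -/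
def BianchiType.signs : BianchiType → Fin 3 → SignType
  | .I => ![0, 0, 0]
  | .II => ![1, 0, 0]
  | .VI₀ => ![0, 1, -1]
  | .VII₀ => ![0, 1, 1]
  | .VIII => ![-1, 1, 1]
  | .IX => ![1, 1, 1]

/-! ### Spacetimes on `I × G`

Vector fields on `ℝ × G` that are invariant under left translations and independent of the first
variable are identified with elements of `ℝ × 𝔤`, where `(1, 0)` is `∂_t`. The frame
`∂_t, e₁, e₂, e₃` is indexed by `Option (Fin 3)`. -/

/-- The metric `-dt² + ∑ i, a_i(t)² ξ^i ⊗ ξ^i`, where the `ξ^i` are the duals of the basis `e`. -/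
def diagonalMetric (e : Module.Basis (Fin 3) ℝ 𝔤) (a : Fin 3 → ℝ → ℝ) (t : ℝ) (X Y : ℝ × 𝔤) : ℝ :=
  -(X.1 * Y.1) + ∑ i, a i t ^ 2 * (e.coord i X.2 * e.coord i Y.2)

/-- The frame `∂_t, e₁, e₂, e₃`. -/
def spacetimeFrame (e : Module.Basis (Fin 3) ℝ 𝔤) : Option (Fin 3) → ℝ × 𝔤
  | none => (1, 0)
  | some i => (0, e i)

/-- The structure constants of the frame `∂_t, e₁, e₂, e₃`; note that `[∂_t, e_i] = 0`. -/
def spacetimeConstants (e : Module.Basis (Fin 3) ℝ 𝔤) :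
    Option (Fin 3) → Option (Fin 3) → Option (Fin 3) → ℝ
  | some i, some j, some k => structureConstants e i j k
  | _, _, _ => 0

/-- The derivatives of the function `t` along `∂_t, e₁, e₂, e₃`. -/
def spacetimeDt : Option (Fin 3) → ℝ
  | none => 1
  | some _ => 0

/-- The components of a spacetime metric in the frame `∂_t, e₁, e₂, e₃`. -/
def spacetimeComponents (e : Module.Basis (Fin 3) ℝ 𝔤) (gbar : ℝ → ℝ × 𝔤 → ℝ × 𝔤 → ℝ) (t : ℝ) :
    Matrix (Option (Fin 3)) (Option (Fin 3)) ℝ :=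
  Matrix.of fun α β => gbar t (spacetimeFrame e α) (spacetimeFrame e β)

/-- The components of the Ricci tensor of a spacetime metric in the frame `∂_t, e₁, e₂, e₃`. -/
def spacetimeRicci (e : Module.Basis (Fin 3) ℝ 𝔤) (gbar : ℝ → ℝ × 𝔤 → ℝ × 𝔤 → ℝ)
    (α β : Option (Fin 3)) (t : ℝ) : ℝ :=
  frameRicci (spacetimeConstants e) spacetimeDt (spacetimeComponents e gbar) α β t

/-- The second fundamental form `⟨∇_{e_i} e_j, ∂_t⟩ = -⟨∇_{e_i} ∂_t, e_j⟩` of `{t} × G`. -/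
def secondFundamentalForm (e : Module.Basis (Fin 3) ℝ 𝔤) (gbar : ℝ → ℝ × 𝔤 → ℝ × 𝔤 → ℝ)
    (i j : Fin 3) (t : ℝ) : ℝ :=
  frameKoszul (spacetimeConstants e) spacetimeDt (spacetimeComponents e gbar)
    (some i) (some j) none t

namespace ClassAData

variable (D : ClassAData 𝔤)

/-- `e` is a canonical basis of Bianchi type `T` for the initial data, `n` and `κ` being the
diagonal elements of the matrix `n^{ij}` (so `[e_j, e_k] = ε_{jkl} n_l e_l`) and of `k`. -/
structure IsCanonicalBasis (e : Module.Basis (Fin 3) ℝ 𝔤) (T : BianchiType) (n κ : Fin 3 → ℝ) :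
    Prop where
  orthonormal : ∀ i j, D.g (e i) (e j) = if i = j then 1 else 0
  diagonal : ∀ i j, D.k (e i) (e j) = if i = j then κ i else 0
  bracket₁₂ : ⁅e 0, e 1⁆ = n 2 • e 2
  bracket₂₃ : ⁅e 1, e 2⁆ = n 0 • e 0
  bracket₃₁ : ⁅e 2, e 0⁆ = n 1 • e 1
  signs : ∀ i, SignType.sign (n i) = T.signs i

/-- `e` is a basis of NUT type: a canonical basis of Bianchi type VIII with `k₂ = k₃`, `n₂ = n₃`. -/
def IsNUTBasis (e : Module.Basis (Fin 3) ℝ 𝔤) : Prop :=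
  ∃ n κ, D.IsCanonicalBasis e .VIII n κ ∧ κ 1 = κ 2 ∧ n 1 = n 2

/-- NUT initial data. -/
def IsNUT : Prop := ∃ e, D.IsNUTBasis e

/-- The metric `-dt² + ∑ i, a_i(t)² ξ^i ⊗ ξ^i` on `I × G`, with the `ξ^i` dual to `e`, solves
Einstein's vacuum equations and induces the initial data on `{0} × G`. -/
structure IsVacuumDevelopment (e : Module.Basis (Fin 3) ℝ 𝔤) (I : Set ℝ) (a : Fin 3 → ℝ → ℝ) :
    Prop where
  isOpen : IsOpen I
  ordConnected : I.OrdConnected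
  zero_mem : (0 : ℝ) ∈ I
  smooth : ∀ i, ContDiffOn ℝ ∞ (a i) I
  pos : ∀ i, ∀ t ∈ I, 0 < a i t
  ricci : ∀ t ∈ I, ∀ α β, spacetimeRicci e (diagonalMetric e a) α β t = 0
  inducedMetric : ∀ X Y : 𝔤, diagonalMetric e a 0 (0, X) (0, Y) = D.g X Y
  inducedForm : ∀ i j, secondFundamentalForm e (diagonalMetric e a) i j 0 = D.k (e i) (e j)

/-- The class A development `(I × G, gbar)` of the initial data: the vacuum development obtained
from a canonical basis, on its maximal interval of existence. -/
def IsClassADevelopment (I : Set ℝ) (gbar : ℝ → ℝ × 𝔤 → ℝ × 𝔤 → ℝ) : Prop :=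
  ∃ (e : Module.Basis (Fin 3) ℝ 𝔤) (T : BianchiType) (n κ : Fin 3 → ℝ) (a : Fin 3 → ℝ → ℝ),
    D.IsCanonicalBasis e T n κ ∧ D.IsVacuumDevelopment e I a ∧
    (∀ J b, D.IsVacuumDevelopment e J b → J ⊆ I) ∧
    ∀ t ∈ I, gbar t = diagonalMetric e a t

end ClassAData

end

/-!
The vacuum equations for NUT data can be solved explicitly, and every development of the data has
to agree with that solution.

Indices run from `1` to `3` in the formulas of this comment and from `0` to `2` in the code.

In a canonical basis `e` the Ricci tensor of `-dt² + ∑ i, a_i² ξ^i ⊗ ξ^i` is diagonal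
(`spacetimeRicci_diagonalMetric`), and its spatial components prescribe the second derivatives of
the scale factors as smooth functions of `a_i > 0` and `a_i'`. Two developments with respect to
the same basis therefore agree wherever both are defined
(`ClassAData.IsVacuumDevelopment.eq_of_mem`).

Put `q = n₁ / 2`, `p = k₂² + q²` and `c = -n₁ n₂ / p > 0`. The Taub-NUT solution is `a₁² = f(x)`,
`a₂² = a₃² = (x² + q²) / p`, where `f(x) = c (x² + μ x - q²) / (x² + q²)` and `x` is a function of
time with `x' = p √f(x)` (`diagonalRicci_nut`). The Hamiltonian constraint reads `k₂ (k₂ + 2 k₁) =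
n₁² / 4 - n₁ n₂ > 0`, so that `k₂` and the trace `k₁ + 2 k₂` have the same sign and do not vanish.
In the time orientation in which the trace is negative the initial value of `x` is `|k₂| > 0`, and
`μ` is determined by `a₁ = 1` at the initial time. The numerator of `f` has exactly one positive
root `r`, the initial value of `x` lies beyond it, and `f` is positive and bounded there. Hence
`x` exists for all positive times. In the other direction it either exists forever or tends to
`r`, and there `a₁` tends to zero, so that no development can extend further; this identifies the
maximal interval without any integrability argument at the root (`exists_solution_of_autonomous`,
`ClassAData.IsCanonicalBasis.exists_nut_development`).

As `f = c + O(1/x)` at infinity, `x = p √c t + O(log t)`, which gives the asymptotic expansions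
(`nutScaleFactors_asymptotics`).

Finally, the basis that defines a development may be any canonical basis. The Killing form is
diagonal in all of them, with eigenvalues `-2 n₂ n₃`, `-2 n₃ n₁`, `-2 n₁ n₂`. For NUT data the
first one is negative and the other two are equal and positive, which forces every canonical basis
to be of NUT type (`ClassAData.IsCanonicalBasis.isNUTBasis`).
-/

noncomputable section

variable {𝔤 : Type*} [LieRing 𝔤] [LieAlgebra ℝ 𝔤]

/-! ### Curvature of diagonal class A metrics -/

/-- The structure constants `[e j, e k] = ε_{jkl} n l • e l`. -/
def classAConstants (n : Fin 3 → ℝ) : Fin 3 → Fin 3 → Fin 3 → ℝ :=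
  ![![![0, 0, 0], ![0, 0, n 2], ![0, -n 1, 0]],
    ![![0, 0, -n 2], ![0, 0, 0], ![n 0, 0, 0]],
    ![![0, n 1, 0], ![-n 0, 0, 0], ![0, 0, 0]]]

theorem ClassAData.IsCanonicalBasis.structureConstants_eq {D : ClassAData 𝔤}
    {e : Module.Basis (Fin 3) ℝ 𝔤} {T : BianchiType} {n κ : Fin 3 → ℝ}
    (h : D.IsCanonicalBasis e T n κ) : structureConstants e = classAConstants n := by
  have h21 : ⁅e 1, e 0⁆ = -(n 2 • e 2) := by rw [← lie_skew, h.bracket₁₂]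
  have h32 : ⁅e 2, e 1⁆ = -(n 0 • e 0) := by rw [← lie_skew, h.bracket₂₃]
  have h13 : ⁅e 0, e 2⁆ = -(n 1 • e 1) := by rw [← lie_skew, h.bracket₃₁]
  funext i j k
  fin_cases i <;> fin_cases j <;> fin_cases k <;>
    simp [structureConstants, classAConstants, h.bracket₁₂, h.bracket₂₃, h.bracket₃₁, h21, h32,
      h13]

section Frame

variable {ι : Type} [Fintype ι] [DecidableEq ι]

theorem frameConnection_of_diagonal (C : ι → ι → ι → ℝ) (d : ι → ℝ) {g : ℝ → Matrix ι ι ℝ}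
    {w : ι → ℝ} {t : ℝ} (hg : g t = Matrix.diagonal w) (hw : ∀ α, w α ≠ 0) (α β γ : ι) :
    frameConnection C d g α β γ t = frameKoszul C d g α β γ t / w γ := by
  have hi : (g t)⁻¹ = Matrix.diagonal fun α => (w α)⁻¹ := by
    apply Matrix.inv_eq_right_inv
    rw [hg, Matrix.diagonal_mul_diagonal]
    simp [hw]
  rw [frameConnection, hi, Finset.sum_eq_single γ]
  · simp [div_eq_mul_inv]
  · intro δ _ hδ
    simp [Matrix.diagonal_apply_ne _ hδ]
  · simp

end Frame

/-- The connection coefficients of `-dt² + ∑ i, x_i² ξ^i ⊗ ξ^i` in the frame `∂_t, e₁, e₂, e₃` with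
structure constants `classAConstants n`, where `y` is the derivative of `x`: the component of
`∇_{E α} E β` along `E γ` is `diagonalConnection n x y α β γ`. -/
def diagonalConnection (n x y : Fin 3 → ℝ) :
    Option (Fin 3) → Option (Fin 3) → Option (Fin 3) → ℝ
  | none, some i, some j => if i = j then y i / x i else 0
  | some i, none, some j => if i = j then y i / x i else 0
  | some i, some j, none => if i = j then x i * y i else 0
  | some i, some j, some k =>
    (classAConstants n i j k * x k ^ 2 - classAConstants n i k j * x j ^ 2
      - classAConstants n j k i * x i ^ 2) / 2 / x k ^ 2
  | _, _, _ => 0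

theorem spacetimeComponents_diagonalMetric (e : Module.Basis (Fin 3) ℝ 𝔤) (a : Fin 3 → ℝ → ℝ)
    (t : ℝ) : spacetimeComponents e (diagonalMetric e a) t =
      Matrix.diagonal fun α => α.elim (-1) fun i => a i t ^ 2 := by
  ext α β
  rcases α with _ | i <;> rcases β with _ | j
  · simp [spacetimeComponents, diagonalMetric, spacetimeFrame]
  · simp [spacetimeComponents, diagonalMetric, spacetimeFrame]
  · simp [spacetimeComponents, diagonalMetric, spacetimeFrame]
  · by_cases hij : i = j
    · subst hij
      simp [spacetimeComponents, diagonalMetric, spacetimeFrame, Finsupp.single_apply]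
    · simp [spacetimeComponents, diagonalMetric, spacetimeFrame, Finsupp.single_apply, hij,
        Matrix.diagonal_apply_ne]

theorem deriv_spacetimeComponents {e : Module.Basis (Fin 3) ℝ 𝔤} {a : Fin 3 → ℝ → ℝ}
    {y : Fin 3 → ℝ} {t : ℝ} (ha : ∀ i, HasDerivAt (a i) (y i) t) (α β : Option (Fin 3)) :
    deriv (fun s => spacetimeComponents e (diagonalMetric e a) s α β) t =
      if α = β then α.elim 0 fun i => 2 * a i t * y i else 0 := by
  simp only [spacetimeComponents_diagonalMetric]
  rcases eq_or_ne α β with rfl | h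
  · rcases α with _ | i
    · simp
    · simpa using ((ha i).fun_pow 2).deriv
  · simp [h]

theorem frameConnection_diagonalMetric {e : Module.Basis (Fin 3) ℝ 𝔤} {n : Fin 3 → ℝ}
    (he : structureConstants e = classAConstants n) {a : Fin 3 → ℝ → ℝ} {y : Fin 3 → ℝ} {t : ℝ}
    (ha : ∀ i, HasDerivAt (a i) (y i) t) (ha0 : ∀ i, a i t ≠ 0) (α β γ : Option (Fin 3)) :
    frameConnection (spacetimeConstants e) spacetimeDt (spacetimeComponents e (diagonalMetric e a))
      α β γ t = diagonalConnection n (fun i => a i t) y α β γ := by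
  rw [frameConnection_of_diagonal _ _ (spacetimeComponents_diagonalMetric e a t)
    (by rintro (_ | i) <;> simp [ha0])]
  rw [frameKoszul]
  simp only [deriv_spacetimeComponents ha]
  simp only [spacetimeComponents_diagonalMetric]
  rcases α with _ | i <;> rcases β with _ | j <;> rcases γ with _ | k <;>
    simp [spacetimeConstants, spacetimeDt, diagonalConnection, he, Matrix.diagonal_apply]
  · have := ha0 j
    have := ha0 k
    by_cases h : j = k
    · subst h
      simp
      field_simp
    · simp [h]
  · have := ha0 i
    by_cases h : i = k
    · subst h
      simp
      field_simp
    · simp [h]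
  · by_cases h : i = j
    · subst h
      simp
      ring
    · simp [h]

/-- The second fundamental form is minus half the time derivative of the metric. -/
theorem secondFundamentalForm_diagonalMetric {e : Module.Basis (Fin 3) ℝ 𝔤} {a : Fin 3 → ℝ → ℝ}
    {y : Fin 3 → ℝ} {t : ℝ} (ha : ∀ i, HasDerivAt (a i) (y i) t) (i j : Fin 3) :
    secondFundamentalForm e (diagonalMetric e a) i j t = if i = j then -(a i t * y i) else 0 := by
  rw [secondFundamentalForm, frameKoszul]
  simp only [deriv_spacetimeComponents ha]
  simp only [spacetimeComponents_diagonalMetric]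
  by_cases h : i = j
  · subst h
    simp [spacetimeConstants, spacetimeDt, Fintype.sum_option]
    ring
  · simp [h, spacetimeConstants, spacetimeDt, Fintype.sum_option]

/-- The Ricci tensor of `-dt² + ∑ i, x_i² ξ^i ⊗ ξ^i` in the frame `∂_t, e₁, e₂, e₃`, where `y` and
`z` are the first and second derivatives of `x`. -/
def diagonalRicci (n x y z : Fin 3 → ℝ) (α : Option (Fin 3)) : ℝ :=
  α.elim (-∑ i, z i / x i) fun i =>
    x i * z i + x i * y i * (∑ j, y j / x j - y i / x i)
      + x i ^ 2 * ((n i * x i ^ 2) ^ 2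
        - (n (i + 1) * x (i + 1) ^ 2 - n (i + 2) * x (i + 2) ^ 2) ^ 2) / (2 * (x 0 * x 1 * x 2) ^ 2)

set_option maxHeartbeats 800000 in
/-- The Ricci tensor of a diagonal class A metric is diagonal. The connection coefficients are
differentiated once, so that `b` has to be the derivative of `a` near `t`, not only at `t`. -/
theorem spacetimeRicci_diagonalMetric {e : Module.Basis (Fin 3) ℝ 𝔤} {n : Fin 3 → ℝ}
    (he : structureConstants e = classAConstants n) {a b : Fin 3 → ℝ → ℝ} {z : Fin 3 → ℝ} {t : ℝ}
    (ha : ∀ i, ∀ᶠ s in nhds t, HasDerivAt (a i) (b i s) s) (hb : ∀ i, HasDerivAt (b i) (z i) t)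
    (ha0 : ∀ i, a i t ≠ 0) (α β : Option (Fin 3)) :
    spacetimeRicci e (diagonalMetric e a) α β t =
      if α = β then diagonalRicci n (fun i => a i t) (fun i => b i t) z α else 0 := by
  have hat : ∀ i, HasDerivAt (a i) (b i t) t := fun i => (ha i).self_of_nhds
  have hev : ∀ α β γ, (fun s => frameConnection (spacetimeConstants e) spacetimeDt
      (spacetimeComponents e (diagonalMetric e a)) α β γ s) =ᶠ[nhds t]
      fun s => diagonalConnection n (fun i => a i s) (fun i => b i s) α β γ := by
    intro α β γ
    have h0 : ∀ i, ∀ᶠ s in nhds t, a i s ≠ 0 := fun i =>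
      (hat i).continuousAt.eventually_ne (ha0 i)
    filter_upwards [Filter.eventually_all.2 ha, Filter.eventually_all.2 h0] with s h1 h2
    exact frameConnection_diagonalMetric he h1 h2 α β γ
  have hd1 : ∀ i, deriv (fun s => b i s / a i s) t
      = (z i * a i t - b i t * b i t) / a i t ^ 2 := fun i =>
    ((hb i).div (hat i) (ha0 i)).deriv
  have hd2 : ∀ i, deriv (fun s => a i s * b i s) t = b i t * b i t + a i t * z i := fun i =>
    ((hat i).mul (hb i)).deriv
  simp only [spacetimeRicci, frameRicci, frameCurvature, (hev _ _ _).deriv_eq,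
    frameConnection_diagonalMetric he hat ha0]
  have h0 := ha0 0
  have h1 := ha0 1
  have h2 := ha0 2
  rcases α with _ | i <;> rcases β with _ | j
  · simp [diagonalConnection, diagonalRicci, Fintype.sum_option, Fin.sum_univ_three, hd1, spacetimeDt,
      spacetimeConstants]
    field_simp
    ring
  · fin_cases j <;>
      simp [diagonalConnection, Fintype.sum_option, Fin.sum_univ_three, spacetimeDt, classAConstants,
        spacetimeConstants]
  · fin_cases i <;>
      simp [diagonalConnection, Fintype.sum_option, Fin.sum_univ_three, spacetimeDt, classAConstants,
        spacetimeConstants, he]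
  · simp only [diagonalConnection, Fintype.sum_option, Fin.sum_univ_three, spacetimeDt,
      spacetimeConstants, he, zero_mul, mul_zero, zero_add, sub_zero, one_mul]
    fin_cases i <;> fin_cases j <;>
      simp [diagonalRicci, Fin.sum_univ_three, hd2, classAConstants] <;>
      field_simp <;> ring

namespace ClassAData.IsCanonicalBasis

variable {D : ClassAData 𝔤} {e : Module.Basis (Fin 3) ℝ 𝔤} {T : BianchiType} {n κ : Fin 3 → ℝ}

theorem components_eq_one (h : D.IsCanonicalBasis e T n κ) : components e D.g = 1 := by
  ext i j
  simp [components, h.orthonormal, Matrix.one_apply]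

theorem metricTrace_eq (h : D.IsCanonicalBasis e T n κ) : metricTrace e D.g D.k = ∑ i, κ i := by
  simp [metricTrace, h.components_eq_one, Matrix.one_apply, h.diagonal]

theorem metricNormSq_eq (h : D.IsCanonicalBasis e T n κ) :
    metricNormSq e D.g D.k = ∑ i, κ i ^ 2 := by
  simp [metricNormSq, h.components_eq_one, Fin.sum_univ_three, h.diagonal]
  ring

theorem leftScalarCurvature_eq (h : D.IsCanonicalBasis e T n κ) :
    leftScalarCurvature e D.g =
      n 0 * n 1 + n 1 * n 2 + n 2 * n 0 - (n 0 ^ 2 + n 1 ^ 2 + n 2 ^ 2) / 2 := by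
  have hc : ∀ i j k, frameConnection (structureConstants e) 0 (fun _ => components e D.g) i j k 0 =
      (classAConstants n i j k - classAConstants n i k j - classAConstants n j k i) / 2 := by
    intro i j k
    rw [frameConnection_of_diagonal (w := fun _ => 1) _ _
      (by rw [h.components_eq_one]; exact Matrix.diagonal_one.symm) (by simp), frameKoszul]
    simp [h.components_eq_one, h.structureConstants_eq, Matrix.one_apply]
  simp only [leftScalarCurvature, frameRicci, frameCurvature, hc]
  simp only [h.components_eq_one, h.structureConstants_eq]
  simp [Fin.sum_univ_three, classAConstants]
  ring

/-- The Hamiltonian constraint in a canonical basis. -/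
theorem hamiltonian_eq (h : D.IsCanonicalBasis e T n κ) :
    n 0 * n 1 + n 1 * n 2 + n 2 * n 0 - (n 0 ^ 2 + n 1 ^ 2 + n 2 ^ 2) / 2 - ∑ i, κ i ^ 2
      + (∑ i, κ i) ^ 2 = 0 := by
  rw [← h.leftScalarCurvature_eq, ← h.metricNormSq_eq, ← h.metricTrace_eq]
  exact D.hamiltonian e

/-! ### Canonical bases of NUT data -/

theorem killingForm_apply (h : D.IsCanonicalBasis e T n κ) (i j : Fin 3) :
    killingForm ℝ 𝔤 (e i) (e j) = if i = j then -2 * n (i + 1) * n (i + 2) else 0 := by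
  rw [killingForm_apply_apply, LinearMap.trace_eq_matrix_trace ℝ e]
  have hm : ∀ i j k, e.repr ⁅e i, e j⁆ k = classAConstants n i j k := fun i j k =>
    congr_fun (congr_fun (congr_fun h.structureConstants_eq i) j) k
  have ha : ∀ i, LinearMap.toMatrix e e (LieAlgebra.ad ℝ 𝔤 (e i)) =
      Matrix.of fun k j => classAConstants n i j k := by
    intro i
    ext k j
    simp [LinearMap.toMatrix_apply, hm]
  rw [LinearMap.toMatrix_comp e e e, ha, ha, Matrix.trace_fin_three]
  fin_cases i <;> fin_cases j <;>
    simp [Matrix.mul_apply, Fin.sum_univ_three, classAConstants] <;> ring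

theorem repr_apply (h : D.IsCanonicalBasis e T n κ) (X : 𝔤) (j : Fin 3) :
    e.repr X j = D.g X (e j) := by
  conv_rhs => rw [← e.sum_repr X]
  simp [-Module.Basis.sum_repr, h.orthonormal]

/-- A bilinear form that is diagonal in a canonical basis. -/
theorem apply_of_diagonal {B : 𝔤 →ₗ[ℝ] 𝔤 →ₗ[ℝ] ℝ} {b : Fin 3 → ℝ}
    (hB : ∀ i j, B (e i) (e j) = if i = j then b i else 0) (h : D.IsCanonicalBasis e T n κ)
    (X : 𝔤) (j : Fin 3) : B X (e j) = D.g X (e j) * b j := by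
  rw [← h.repr_apply]
  conv_lhs => rw [← e.sum_repr X]
  simp [-Module.Basis.sum_repr, hB]

/-- A diagonal form whose last two eigenvalues coincide is proportional to the metric on the
orthogonal complement of `e 0`. -/
theorem apply_of_orthogonal {B : 𝔤 →ₗ[ℝ] 𝔤 →ₗ[ℝ] ℝ} {b : Fin 3 → ℝ}
    (hB : ∀ i j, B (e i) (e j) = if i = j then b i else 0) (h : D.IsCanonicalBasis e T n κ)
    (hb : b 1 = b 2) {X : 𝔤} (hX : D.g X (e 0) = 0) (Y : 𝔤) : B X Y = b 1 * D.g X Y := by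
  have : B X = b 1 • D.g X := by
    refine e.ext fun j => ?_
    rw [apply_of_diagonal hB h]
    fin_cases j
    · simp [hX]
    · simp [mul_comm]
    · simp [hb, mul_comm]
  simp [this]

/-- The Killing form is diagonal in both bases. For the first one it has a simple negative and a
double positive eigenvalue, so that the second basis is a rotation or reflection of the first one
that preserves the line of `e 0`. -/
theorem isNUTBasis {e' : Module.Basis (Fin 3) ℝ 𝔤} {T' : BianchiType} {n' κ' : Fin 3 → ℝ}
    (h : D.IsCanonicalBasis e .VIII n κ) (hκ : κ 1 = κ 2) (hn : n 1 = n 2)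
    (h' : D.IsCanonicalBasis e' T' n' κ') :
    T' = .VIII ∧ κ' 1 = κ' 2 ∧ n' 1 = n' 2 := by
  have hn0 : n 0 < 0 := by simpa [BianchiType.signs, sign_eq_neg_one_iff] using h.signs 0
  have hn1 : 0 < n 1 := by simpa [BianchiType.signs, sign_eq_one_iff] using h.signs 1
  set K := killingForm ℝ 𝔤
  have hK := h.killingForm_apply
  have hK' := h'.killingForm_apply
  -- the eigenvectors of distinct eigenvalues are orthogonal
  have key : ∀ i j, D.g (e' i) (e j) * (-2 * n (j + 1) * n (j + 2)
      - -2 * n' (i + 1) * n' (i + 2)) = 0 := by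
    intro i j
    have h1 := apply_of_diagonal hK h (e' i) j
    have h2 := apply_of_diagonal hK' h' (e j) i
    have h3 : K (e' i) (e j) = K (e j) (e' i) := LieModule.traceForm_comm ℝ 𝔤 𝔤 _ _
    have h4 := D.g_symm (e j) (e' i)
    have h5 : K (e' i) (e j) = D.g (e' i) (e j) * _ := h1
    have h6 : K (e j) (e' i) = D.g (e j) (e' i) * _ := h2
    rw [h4] at h6
    linear_combination h3 - h5 + h6
  have row : ∀ i, ∃ j, D.g (e' i) (e j) ≠ 0 := by
    intro i
    by_contra! hc
    exact e'.ne_zero i (e.repr.map_eq_zero_iff.1 (Finsupp.ext fun j => by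
      simp [h.repr_apply, hc]))
  have col : ∀ j, ∃ i, D.g (e' i) (e j) ≠ 0 := by
    intro j
    by_contra! hc
    exact e.ne_zero j (e'.repr.map_eq_zero_iff.1 (Finsupp.ext fun i => by
      simp [h'.repr_apply, D.g_symm (e j), hc]))
  have hne : ∀ i, n' (i + 1) * n' (i + 2) ≠ 0 := by
    intro i hi
    obtain ⟨j, hj⟩ := row i
    have h1 := (mul_eq_zero.1 (key i j)).resolve_left hj
    have h2 : n (j + 1) * n (j + 2) = 0 := by linarith
    have hnj : ∀ j, n j ≠ 0 := by
      intro j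
      fin_cases j
      · exact hn0.ne
      · exact hn1.ne'
      · exact (hn ▸ hn1).ne'
    exact mul_ne_zero (hnj _) (hnj _) h2
  have hne' : ∀ i, n' i ≠ 0 := fun i => right_ne_zero_of_mul (by
    have := hne (i + 1)
    rwa [show i + 1 + 2 = i by fin_cases i <;> rfl] at this)
  obtain rfl : T' = .VIII := by
    have hs := h'.signs
    obtain ⟨i, hi⟩ := col 1
    have h1 := (mul_eq_zero.1 (key i 1)).resolve_left hi
    have h2 : n' (i + 1) * n' (i + 2) < 0 := by
      have h3 : n (1 + 1) * n (1 + 2) < 0 := mul_neg_of_pos_of_neg (hn ▸ hn1) hn0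
      linarith
    cases T'
    · exact absurd (sign_eq_zero_iff.1 (hs 0)) (hne' 0)
    · exact absurd (sign_eq_zero_iff.1 (hs 1)) (hne' 1)
    · exact absurd (sign_eq_zero_iff.1 (hs 0)) (hne' 0)
    · exact absurd (sign_eq_zero_iff.1 (hs 0)) (hne' 0)
    · rfl
    · have hp : ∀ i, 0 < n' i := fun i => sign_eq_one_iff.1 (by
        rw [hs i]
        fin_cases i <;> rfl)
      exact absurd h2 (mul_pos (hp _) (hp _)).not_gt
  have hn0' : n' 0 < 0 := by simpa [BianchiType.signs, sign_eq_neg_one_iff] using h'.signs 0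
  have hn1' : 0 < n' 1 := by simpa [BianchiType.signs, sign_eq_one_iff] using h'.signs 1
  have hn2' : 0 < n' 2 := by simpa [BianchiType.signs, sign_eq_one_iff] using h'.signs 2
  have hA1 : D.g (e' 1) (e 0) = 0 := by
    refine (mul_eq_zero.1 (key 1 0)).resolve_right ?_
    simp only [Fin.reduceAdd, zero_add]
    nlinarith [mul_pos hn1 hn1, mul_pos hn2' (neg_pos.2 hn0')]
  have hA2 : D.g (e' 2) (e 0) = 0 := by
    refine (mul_eq_zero.1 (key 2 0)).resolve_right ?_
    simp only [Fin.reduceAdd, zero_add]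
    nlinarith [mul_pos hn1 hn1, mul_pos hn1' (neg_pos.2 hn0')]
  have hk1 := apply_of_orthogonal h.diagonal h hκ hA1 (e' 1)
  have hk2 := apply_of_orthogonal h.diagonal h hκ hA2 (e' 2)
  have hKe : -2 * n (1 + 1) * n (1 + 2) = -2 * n (2 + 1) * n (2 + 2) := by
    simp only [Fin.reduceAdd]
    rw [hn]
    ring
  have hK1 := apply_of_orthogonal hK h hKe hA1 (e' 1)
  have hK2 := apply_of_orthogonal hK h hKe hA2 (e' 2)
  rw [h'.diagonal, h'.orthonormal] at hk1 hk2
  rw [hK', h'.orthonormal] at hK1 hK2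
  simp only [Fin.reduceAdd, if_true, mul_one] at hk1 hk2 hK1 hK2
  refine ⟨rfl, hk1.trans hk2.symm, ?_⟩
  have : n' 0 * (n' 1 - n' 2) = 0 := by linarith
  linarith [(mul_eq_zero.1 this).resolve_left hn0'.ne]

end ClassAData.IsCanonicalBasis

/-! ### Uniqueness of vacuum developments -/

/-- The second derivative of the scale factors `x` that the spatial components of Einstein's vacuum
equations prescribe, where `y` is the first derivative. -/
def vacuumAcceleration (n x y : Fin 3 → ℝ) (i : Fin 3) : ℝ :=
  -(y i * (∑ j, y j / x j - y i / x i))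
    - x i * ((n i * x i ^ 2) ^ 2
      - (n (i + 1) * x (i + 1) ^ 2 - n (i + 2) * x (i + 2) ^ 2) ^ 2) / (2 * (x 0 * x 1 * x 2) ^ 2)

theorem diagonalRicci_some_eq_zero_iff {n x y z : Fin 3 → ℝ} {i : Fin 3} (hx : x i ≠ 0) :
    diagonalRicci n x y z (some i) = 0 ↔ z i = vacuumAcceleration n x y i := by
  have h : diagonalRicci n x y z (some i) = x i * (z i - vacuumAcceleration n x y i) := by
    simp only [diagonalRicci, vacuumAcceleration, Option.elim]
    ring
  rw [h, mul_eq_zero, or_iff_right hx, sub_eq_zero]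

theorem contDiffOn_vacuumAcceleration (n : Fin 3 → ℝ) (i : Fin 3) :
    ContDiffOn ℝ 1 (fun p : (Fin 3 → ℝ) × (Fin 3 → ℝ) => vacuumAcceleration n p.1 p.2 i)
      {p | ∀ i, p.1 i ≠ 0} := by
  intro p hp
  have h1 : ∀ j, ContDiffWithinAt ℝ 1 (fun p : (Fin 3 → ℝ) × (Fin 3 → ℝ) => p.1 j)
      {p | ∀ i, p.1 i ≠ 0} p := fun j => by fun_prop
  have h2 : ∀ j, ContDiffWithinAt ℝ 1 (fun p : (Fin 3 → ℝ) × (Fin 3 → ℝ) => p.2 j)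
      {p | ∀ i, p.1 i ≠ 0} p := fun j => by fun_prop
  have h3 : ∀ j, ContDiffWithinAt ℝ 1 (fun p : (Fin 3 → ℝ) × (Fin 3 → ℝ) => p.2 j / p.1 j)
      {p | ∀ i, p.1 i ≠ 0} p := fun j => (h2 j).div (h1 j) (hp j)
  refine (((h2 i).mul ((ContDiffWithinAt.sum fun j _ => h3 j).sub (h3 i))).neg).sub
    (ContDiffWithinAt.div ?_ ?_ ?_)
  · exact (h1 i).mul (((contDiffWithinAt_const.mul ((h1 i).pow 2)).pow 2).sub
      (((contDiffWithinAt_const.mul ((h1 _).pow 2)).sub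
        (contDiffWithinAt_const.mul ((h1 _).pow 2))).pow 2))
  · exact contDiffWithinAt_const.mul ((((h1 0).mul (h1 1)).mul (h1 2)).pow 2)
  · have := hp 0
    have := hp 1
    have := hp 2
    positivity

open Filter Topology Set in
theorem eventually_forall_le_of_pos {g : ℝ → ℝ} {K : Set ℝ} (hK : IsCompact K)
    (hg : ContinuousOn g K) (h0 : ∀ s ∈ K, 0 < g s) : ∀ᶠ c in 𝓝[>] (0 : ℝ), ∀ s ∈ K, c ≤ g s := by
  rcases K.eq_empty_or_nonempty with rfl | hne
  · simp
  obtain ⟨s₀, hs₀, hmin⟩ := hK.exists_isMinOn hne hg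
  filter_upwards [Ioo_mem_nhdsGT (h0 s₀ hs₀)] with c hc s hs
  exact hc.2.le.trans (hmin hs)

open Filter Topology Set in
theorem eventually_forall_abs_le_inv {g : ℝ → ℝ} {K : Set ℝ} (hK : IsCompact K)
    (hg : ContinuousOn g K) : ∀ᶠ c in 𝓝[>] (0 : ℝ), ∀ s ∈ K, |g s| ≤ c⁻¹ := by
  obtain ⟨M, hM⟩ := hK.exists_bound_of_continuousOn hg
  filter_upwards [tendsto_inv_nhdsGT_zero.eventually_ge_atTop M] with c hc s hs
  exact (hM s hs).trans hc

namespace ClassAData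

variable {D : ClassAData 𝔤} {e : Module.Basis (Fin 3) ℝ 𝔤} {T : BianchiType} {n κ : Fin 3 → ℝ}

namespace IsVacuumDevelopment

variable {I : Set ℝ} {a : Fin 3 → ℝ → ℝ}

theorem hasDerivAt (h : D.IsVacuumDevelopment e I a) {t : ℝ} (ht : t ∈ I) (i : Fin 3) :
    HasDerivAt (a i) (deriv (a i) t) t :=
  (((h.smooth i).contDiffAt (h.isOpen.mem_nhds ht)).differentiableAt (by simp)).hasDerivAt

/-- The spatial components of Einstein's vacuum equations as a second order system. -/
theorem hasDerivAt_deriv (hc : D.IsCanonicalBasis e T n κ) (h : D.IsVacuumDevelopment e I a)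
    {t : ℝ} (ht : t ∈ I) (i : Fin 3) :
    HasDerivAt (deriv (a i))
      (vacuumAcceleration n (fun i => a i t) (fun i => deriv (a i) t) i) t := by
  have hd : ∀ i, HasDerivAt (deriv (a i)) (deriv (deriv (a i)) t) t := fun i =>
    ((((contDiffOn_infty_iff_deriv_of_isOpen h.isOpen).1 (h.smooth i)).2.contDiffAt
      (h.isOpen.mem_nhds ht)).differentiableAt (by simp)).hasDerivAt
  have hr := h.ricci t ht (some i) (some i)
  rw [spacetimeRicci_diagonalMetric hc.structureConstants_eq (b := fun i => deriv (a i))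
    (fun i => by filter_upwards [h.isOpen.mem_nhds ht] with s hs using h.hasDerivAt hs i) hd
    (fun i => (h.pos i t ht).ne'), if_pos rfl,
    diagonalRicci_some_eq_zero_iff (h.pos i t ht).ne'] at hr
  rw [← hr]
  exact hd i

theorem apply_zero (hc : D.IsCanonicalBasis e T n κ) (h : D.IsVacuumDevelopment e I a)
    (i : Fin 3) : a i 0 = 1 := by
  have h1 := h.inducedMetric (e i) (e i)
  rw [hc.orthonormal, if_pos rfl] at h1
  have h2 : a i 0 ^ 2 = 1 := by
    simpa [diagonalMetric, Finsupp.single_apply] using h1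
  exact (pow_eq_one_iff_of_nonneg (h.pos i 0 h.zero_mem).le two_ne_zero).1 h2

theorem deriv_zero (hc : D.IsCanonicalBasis e T n κ) (h : D.IsVacuumDevelopment e I a)
    (i : Fin 3) : deriv (a i) 0 = -κ i := by
  have h1 := h.inducedForm i i
  rw [secondFundamentalForm_diagonalMetric (h.hasDerivAt h.zero_mem), hc.diagonal, if_pos rfl,
    if_pos rfl, h.apply_zero hc] at h1
  linarith

/-- The scale factors and their derivatives. -/
def phase (a : Fin 3 → ℝ → ℝ) (t : ℝ) : (Fin 3 → ℝ) × (Fin 3 → ℝ) :=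
  (fun i => a i t, fun i => deriv (a i) t)

theorem hasDerivAt_phase (hc : D.IsCanonicalBasis e T n κ) (h : D.IsVacuumDevelopment e I a)
    {t : ℝ} (ht : t ∈ I) :
    HasDerivAt (phase a) ((phase a t).2, vacuumAcceleration n (phase a t).1 (phase a t).2) t :=
  (hasDerivAt_pi.2 fun i => h.hasDerivAt ht i).prodMk
    (hasDerivAt_pi.2 fun i => h.hasDerivAt_deriv hc ht i)

open Filter Topology Set in
/-- On a compact set of times the scale factors lie in `[c, c⁻¹]` and their derivatives in
`[-c⁻¹, c⁻¹]` for all small `c > 0`. -/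
theorem eventually_phase_mem (hc : D.IsCanonicalBasis e T n κ) (h : D.IsVacuumDevelopment e I a)
    {K : Set ℝ} (hK : IsCompact K) (hKI : K ⊆ I) : ∀ᶠ c in 𝓝[>] (0 : ℝ), ∀ s ∈ K,
      phase a s ∈ Icc ((fun _ => c, fun _ => -c⁻¹) : (Fin 3 → ℝ) × (Fin 3 → ℝ))
        (fun _ => c⁻¹, fun _ => c⁻¹) := by
  have h1 : ∀ i, ContinuousOn (a i) K := fun i s hs =>
    (h.hasDerivAt (hKI hs) i).continuousAt.continuousWithinAt
  have h2 : ∀ i, ContinuousOn (deriv (a i)) K := fun i s hs =>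
    (h.hasDerivAt_deriv hc (hKI hs) i).continuousAt.continuousWithinAt
  filter_upwards [
    eventually_all.2 fun i => eventually_forall_le_of_pos hK (h1 i) fun s hs => h.pos i s (hKI hs),
    eventually_all.2 fun i => eventually_forall_abs_le_inv hK (h1 i),
    eventually_all.2 fun i => eventually_forall_abs_le_inv hK (h2 i)] with c h3 h4 h5 s hs
  exact ⟨⟨fun i => h3 i s hs, fun i => (abs_le.1 (h5 i s hs)).1⟩,
    ⟨fun i => (abs_le.1 (h4 i s hs)).2, fun i => (abs_le.1 (h5 i s hs)).2⟩⟩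

open Filter Topology Set in
/-- Developments with respect to the same basis agree. Between time `0` and `t` both of them stay in
a compact convex set in which the scale factors are bounded away from zero, so that the vector field
is Lipschitz there. -/
theorem eq_of_mem (hc : D.IsCanonicalBasis e T n κ) (h : D.IsVacuumDevelopment e I a)
    {J : Set ℝ} {b : Fin 3 → ℝ → ℝ} (h' : D.IsVacuumDevelopment e J b) {t : ℝ} (hI : t ∈ I)
    (hJ : t ∈ J) (i : Fin 3) : a i t = b i t := by
  have hKI : uIcc 0 t ⊆ I := h.ordConnected.uIcc_subset h.zero_mem hI
  have hKJ : uIcc 0 t ⊆ J := h'.ordConnected.uIcc_subset h'.zero_mem hJ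
  obtain ⟨c, ha, hb, hpos⟩ := ((h.eventually_phase_mem hc isCompact_uIcc hKI).and
    ((h'.eventually_phase_mem hc isCompact_uIcc hKJ).and self_mem_nhdsWithin)).exists
  replace hpos : 0 < c := hpos
  set B := Icc ((fun _ => c, fun _ => -c⁻¹) : (Fin 3 → ℝ) × (Fin 3 → ℝ))
    (fun _ => c⁻¹, fun _ => c⁻¹)
  have hv : ContDiffOn ℝ 1 (fun p : (Fin 3 → ℝ) × (Fin 3 → ℝ) =>
      (p.2, vacuumAcceleration n p.1 p.2)) B :=
    contDiffOn_snd.prodMk (contDiffOn_pi.2 fun i =>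
      (contDiffOn_vacuumAcceleration n i).mono fun p hp i => (hpos.trans_le (hp.1.1 i)).ne')
  obtain ⟨C, hC⟩ := hv.exists_lipschitzOnWith one_ne_zero (convex_Icc _ _) isCompact_Icc
  have h0 : phase a 0 = phase b 0 := by
    simp [phase, h.apply_zero hc, h'.apply_zero hc, h.deriv_zero hc, h'.deriv_zero hc]
  have hfa : ∀ s ∈ uIcc 0 t, HasDerivAt (phase a) _ s := fun s hs =>
    h.hasDerivAt_phase hc (hKI hs)
  have hfb : ∀ s ∈ uIcc 0 t, HasDerivAt (phase b) _ s := fun s hs =>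
    h'.hasDerivAt_phase hc (hKJ hs)
  have heq : phase a t = phase b t := by
    rcases le_total 0 t with ht | ht
    · rw [uIcc_of_le ht] at hfa hfb ha hb
      exact ODE_solution_unique_of_mem_Icc_right (s := fun _ => B) (fun _ _ => hC)
        (HasDerivAt.continuousOn hfa)
        (fun s hs => (hfa s (Ico_subset_Icc_self hs)).hasDerivWithinAt)
        (fun s hs => ha s (Ico_subset_Icc_self hs))
        (HasDerivAt.continuousOn hfb)
        (fun s hs => (hfb s (Ico_subset_Icc_self hs)).hasDerivWithinAt)
        (fun s hs => hb s (Ico_subset_Icc_self hs)) h0 (right_mem_Icc.2 ht)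
    · rw [uIcc_of_ge ht] at hfa hfb ha hb
      exact ODE_solution_unique_of_mem_Icc_left (s := fun _ => B) (fun _ _ => hC)
        (HasDerivAt.continuousOn hfa)
        (fun s hs => (hfa s (Ioc_subset_Icc_self hs)).hasDerivWithinAt)
        (fun s hs => ha s (Ioc_subset_Icc_self hs))
        (HasDerivAt.continuousOn hfb)
        (fun s hs => (hfb s (Ioc_subset_Icc_self hs)).hasDerivWithinAt)
        (fun s hs => hb s (Ioc_subset_Icc_self hs)) h0 (left_mem_Icc.2 ht)
  exact congr_fun (congr_arg Prod.fst heq) i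

end IsVacuumDevelopment

end ClassAData

/-! ### Autonomous equations on a half line -/

section Autonomous

open Filter Topology Set

variable {F : ℝ → ℝ} {r h M : ℝ}

/-- Solutions of `x' = F x` are as smooth as `F`. -/
theorem contDiffOn_of_hasDerivAt_comp {I : Set ℝ} (hI : IsOpen I) {S : Set ℝ} {x : ℝ → ℝ}
    (hF : ContDiffOn ℝ ∞ F S) (hS : MapsTo x I S) (hx : ∀ t ∈ I, HasDerivAt x (F (x t)) t) :
    ContDiffOn ℝ ∞ x I := by
  rw [contDiffOn_infty]
  intro m
  induction m with
  | zero =>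
    exact contDiffOn_zero.2 (HasDerivAt.continuousOn hx)
  | succ m ih =>
    rw [Nat.cast_succ, contDiffOn_succ_iff_deriv_of_isOpen hI]
    refine ⟨fun t ht => (hx t ht).differentiableAt.differentiableWithinAt, by simp, ?_⟩
    exact ((hF.of_le (by exact_mod_cast le_top)).comp ih hS).congr fun t ht => (hx t ht).deriv

/-- The solution of `x' = F x`, `x 0 = h`, on its maximal interval of existence in `Ioi r`, obtained
as the inverse function of `y ↦ ∫ 1 / F`. As `F` is bounded it exists for all positive times. If it
does not exist for all negative times, then it reaches `r` in finite time. -/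
theorem exists_solution_of_autonomous (hr : r < h) (hF : ContDiffOn ℝ ∞ F (Ioi r))
    (hpos : ∀ y ∈ Ioi r, 0 < F y) (hM : ∀ y ∈ Ioi r, F y ≤ M) :
    ∃ (I : Set ℝ) (x : ℝ → ℝ), IsOpen I ∧ I.OrdConnected ∧ Ici 0 ⊆ I ∧ x 0 = h ∧
      (∀ t ∈ I, r < x t) ∧ (∀ t ∈ I, HasDerivAt x (F (x t)) t) ∧ ContDiffOn ℝ ∞ x I ∧
      ∀ s ∉ I, ∃ t₀, s ≤ t₀ ∧ t₀ < 0 ∧ Ioi t₀ ⊆ I ∧ Tendsto x (𝓝[>] t₀) (𝓝 r) := by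
  have hM0 : 0 < M := (hpos h hr).trans_le (hM h hr)
  set S : ℝ → ℝ := fun y => ∫ z in h..y, (F z)⁻¹ with hSdef
  have hc : ContinuousOn (fun z => (F z)⁻¹) (Ioi r) :=
    hF.continuousOn.inv₀ fun y hy => (hpos y hy).ne'
  have hint : ∀ y₁ ∈ Ioi r, ∀ y₂ ∈ Ioi r,
      IntervalIntegrable (fun z => (F z)⁻¹) MeasureTheory.volume y₁ y₂ := fun y₁ h₁ y₂ h₂ =>
    (hc.mono (ordConnected_Ioi.uIcc_subset h₁ h₂)).intervalIntegrable
  have hS : ∀ y ∈ Ioi r, HasStrictDerivAt S (F y)⁻¹ y := fun y hy =>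
    intervalIntegral.integral_hasStrictDerivAt_right (hint h hr y hy)
      (hc.stronglyMeasurableAtFilter isOpen_Ioi y hy)
      (hc.continuousAt (isOpen_Ioi.mem_nhds hy))
  have hSc : ContinuousOn S (Ioi r) := fun y hy =>
    (hS y hy).hasDerivAt.continuousAt.continuousWithinAt
  have hmono : StrictMonoOn S (Ioi r) :=
    strictMonoOn_of_deriv_pos (convex_Ioi r) hSc fun y hy => by
      rw [interior_Ioi] at hy
      rw [(hS y hy).hasDerivAt.deriv]
      exact inv_pos.2 (hpos y hy)
  have hSh : S h = 0 := by simp [hSdef]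
  set x := Function.invFunOn S (Ioi r)
  have hxS : ∀ y ∈ Ioi r, x (S y) = y := fun y hy => hmono.injOn.leftInvOn_invFunOn hy
  have hopen : IsOpen (S '' Ioi r) := by
    rw [isOpen_iff_mem_nhds]
    rintro _ ⟨y, hy, rfl⟩
    rw [← (hS y hy).map_nhds_eq (inv_pos.2 (hpos y hy)).ne']
    exact image_mem_map (isOpen_Ioi.mem_nhds hy)
  have hord : (S '' Ioi r).OrdConnected := (isPreconnected_Ioi.image S hSc).ordConnected
  have hlarge : Ici 0 ⊆ S '' Ioi r := by
    intro t (ht : 0 ≤ t)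
    have hy : h + M * t ∈ Ioi r := by
      have : 0 ≤ M * t := by positivity
      exact hr.trans_le (by linarith)
    refine hord.out ⟨h, hr, hSh⟩ ⟨_, hy, rfl⟩ ⟨ht, ?_⟩
    have h1 : ∫ _ in h..(h + M * t), M⁻¹ ≤ S (h + M * t) := by
      refine intervalIntegral.integral_mono_on (by nlinarith) (by simp) (hint h hr _ hy) ?_
      intro z hz
      have hz' : z ∈ Ioi r := hr.trans_le hz.1
      exact inv_anti₀ (hpos z hz') (hM z hz')
    rwa [intervalIntegral.integral_const, add_sub_cancel_left, smul_eq_mul,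
      mul_right_comm, mul_inv_cancel₀ hM0.ne', one_mul] at h1
  have hxr : ∀ t ∈ S '' Ioi r, r < x t := by
    rintro _ ⟨y, hy, rfl⟩
    rw [hxS y hy]
    exact hy
  have hxd : ∀ t ∈ S '' Ioi r, HasDerivAt x (F (x t)) t := by
    rintro _ ⟨y, hy, rfl⟩
    rw [hxS y hy]
    have := (hS y hy).to_local_left_inverse (inv_pos.2 (hpos y hy)).ne'
      (g := x) (by filter_upwards [isOpen_Ioi.mem_nhds hy] with z hz using hxS z hz)
    rw [inv_inv] at this
    exact this.hasDerivAt
  refine ⟨S '' Ioi r, x, hopen, hord, hlarge, ?_, hxr, hxd,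
    contDiffOn_of_hasDerivAt_comp hopen hF hxr hxd, ?_⟩
  · rw [← hSh, hxS h hr]
  intro s hs
  have h0 : (0 : ℝ) ∈ S '' Ioi r := hlarge self_mem_Ici
  have hlow : ∀ t ∈ S '' Ioi r, s ≤ t := by
    intro t ht
    by_contra! hlt
    have hs0 : s ≤ 0 := by
      by_contra! h
      exact hs (hlarge h.le)
    exact hs (hord.out ht h0 ⟨hlt.le, hs0⟩)
  have hbdd : BddBelow (S '' Ioi r) := ⟨s, hlow⟩
  have hne : (S '' Ioi r).Nonempty := ⟨0, h0⟩
  -- an open set does not contain its infimum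
  have hinf : ∀ t ∈ S '' Ioi r, sInf (S '' Ioi r) < t := by
    intro t ht
    have hn : S '' Ioi r ∈ 𝓝[<] t := mem_nhdsWithin_of_mem_nhds (hopen.mem_nhds ht)
    obtain ⟨t', ht', hlt⟩ := Filter.nonempty_of_mem (inter_mem hn self_mem_nhdsWithin)
    exact (csInf_le hbdd ht').trans_lt hlt
  refine ⟨sInf (S '' Ioi r), le_csInf hne hlow, hinf 0 h0, ?_, ?_⟩
  · intro t ht
    obtain ⟨t', ht', hlt⟩ := exists_lt_of_csInf_lt hne ht
    exact hord.out ht' (hlarge (le_max_right t 0)) ⟨hlt.le, le_max_left t 0⟩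
  · have hsub : ∀ᶠ t in 𝓝[>] sInf (S '' Ioi r), t ∈ S '' Ioi r := by
      filter_upwards [self_mem_nhdsWithin] with t ht
      obtain ⟨t', ht', hlt⟩ := exists_lt_of_csInf_lt hne ht
      exact hord.out ht' (hlarge (le_max_right t 0)) ⟨hlt.le, le_max_left t 0⟩
    refine tendsto_order.2 ⟨fun y hy => ?_, fun y hy => ?_⟩
    · filter_upwards [hsub] with t ht using hy.trans (hxr t ht)
    · filter_upwards [hsub, Ioo_mem_nhdsGT (hinf (S y) ⟨y, hy, rfl⟩)] with t ht hty
      obtain ⟨z, hz, rfl⟩ := ht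
      rw [hxS z hz]
      exact (hmono.lt_iff_lt hz hy).1 hty.2

end Autonomous

/-! ### The Taub-NUT potential -/

section Potential

open Filter Topology Set

/-- The function `f` for which `a₀² = f(x)`, `a₁² = a₂² = (x² + q²) / p` and `x' = p √f(x)` is a
vacuum solution. -/
def nutPotential (c μ q x : ℝ) : ℝ := c * (x ^ 2 + μ * x - q ^ 2) / (x ^ 2 + q ^ 2)

/-- The derivative of `nutPotential`. -/
def nutPotentialDeriv (c μ q x : ℝ) : ℝ :=
  (c * (2 * x + μ) - 2 * x * nutPotential c μ q x) / (x ^ 2 + q ^ 2)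

/-- The second derivative of `nutPotential`. -/
def nutPotentialDeriv₂ (c μ q x : ℝ) : ℝ :=
  (2 * c - 4 * x * nutPotentialDeriv c μ q x - 2 * nutPotential c μ q x) / (x ^ 2 + q ^ 2)

variable {c μ q : ℝ}

theorem nutPotential_mul (hq : q ≠ 0) (x : ℝ) :
    nutPotential c μ q x * (x ^ 2 + q ^ 2) = c * (x ^ 2 + μ * x - q ^ 2) :=
  div_mul_cancel₀ _ (by positivity)

theorem nutPotentialDeriv_mul (hq : q ≠ 0) (x : ℝ) :
    nutPotentialDeriv c μ q x * (x ^ 2 + q ^ 2) =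
      c * (2 * x + μ) - 2 * x * nutPotential c μ q x :=
  div_mul_cancel₀ _ (by positivity)

theorem nutPotentialDeriv₂_mul (hq : q ≠ 0) (x : ℝ) :
    nutPotentialDeriv₂ c μ q x * (x ^ 2 + q ^ 2) =
      2 * c - 4 * x * nutPotentialDeriv c μ q x - 2 * nutPotential c μ q x :=
  div_mul_cancel₀ _ (by positivity)

theorem hasDerivAt_nutPotential (hq : q ≠ 0) (x : ℝ) :
    HasDerivAt (nutPotential c μ q) (nutPotentialDeriv c μ q x) x := by
  have hS : x ^ 2 + q ^ 2 ≠ 0 := by positivity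
  have hN : HasDerivAt (fun x => c * (x ^ 2 + μ * x - q ^ 2)) (c * (2 * x + μ)) x := by
    have := ((((hasDerivAt_pow 2 x).add ((hasDerivAt_id x).const_mul μ)).sub_const (q ^ 2)).const_mul
      c)
    convert! this using 1
    simp
  have hD : HasDerivAt (fun x => x ^ 2 + q ^ 2) (2 * x) x := by
    simpa using (hasDerivAt_pow 2 x).add_const (q ^ 2)
  convert! hN.div hD hS using 1
  rw [nutPotentialDeriv, nutPotential]
  field_simp

theorem hasDerivAt_nutPotentialDeriv (hq : q ≠ 0) (x : ℝ) :
    HasDerivAt (nutPotentialDeriv c μ q) (nutPotentialDeriv₂ c μ q x) x := by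
  have hS : x ^ 2 + q ^ 2 ≠ 0 := by positivity
  have hN : HasDerivAt (fun x => c * (2 * x + μ) - 2 * x * nutPotential c μ q x)
      (2 * c - 2 * x * nutPotentialDeriv c μ q x - 2 * nutPotential c μ q x) x := by
    have := ((((hasDerivAt_id x).const_mul 2).add_const μ).const_mul c).sub
      (((hasDerivAt_id x).const_mul 2).mul (hasDerivAt_nutPotential (c := c) (μ := μ) hq x))
    convert! this using 1
    simp
    ring
  have hD : HasDerivAt (fun x => x ^ 2 + q ^ 2) (2 * x) x := by
    simpa using (hasDerivAt_pow 2 x).add_const (q ^ 2)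
  convert! hN.div hD hS using 1
  rw [nutPotentialDeriv₂, eq_div_iff (by positivity), div_mul_eq_mul_div, div_eq_iff hS]
  linear_combination (-2 * x * (x ^ 2 + q ^ 2)) * nutPotentialDeriv_mul (c := c) (μ := μ) hq x

theorem contDiff_nutPotential (hq : q ≠ 0) : ContDiff ℝ ∞ (nutPotential c μ q) := by
  unfold nutPotential
  exact ContDiff.div (by fun_prop) (by fun_prop) fun x => by positivity

/-- The positive root of the numerator of `nutPotential`; the other root is `-q² / r`. -/
theorem exists_root (hq : q ≠ 0) (μ : ℝ) :
    ∃ r > 0, ∀ x : ℝ, x ^ 2 + μ * x - q ^ 2 = (x - r) * (x + q ^ 2 / r) := by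
  have hq2 : 0 < q ^ 2 := by positivity
  have hs : |μ| < √(μ ^ 2 + 4 * q ^ 2) := Real.lt_sqrt_of_sq_lt (by rw [sq_abs]; linarith)
  have hr : 0 < (-μ + √(μ ^ 2 + 4 * q ^ 2)) / 2 := by linarith [le_abs_self μ]
  refine ⟨_, hr, fun x => ?_⟩
  set r := (-μ + √(μ ^ 2 + 4 * q ^ 2)) / 2 with hrdef
  have hr2 : r ^ 2 + μ * r - q ^ 2 = 0 := by
    rw [hrdef]
    linear_combination (1 / 4) * Real.sq_sqrt (by positivity : 0 ≤ μ ^ 2 + 4 * q ^ 2)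
  have hμ : μ = q ^ 2 / r - r := by
    field_simp
    linarith
  rw [hμ]
  field_simp
  ring

theorem nutPotential_pos (hq : q ≠ 0) (hc : 0 < c) {r : ℝ} (hr : 0 < r)
    (hroot : ∀ x : ℝ, x ^ 2 + μ * x - q ^ 2 = (x - r) * (x + q ^ 2 / r)) {x : ℝ} (hx : r < x) :
    0 < nutPotential c μ q x := by
  have h1 : 0 < x - r := sub_pos.2 hx
  have h2 : 0 < x := hr.trans hx
  rw [nutPotential, hroot]
  positivity

theorem nutPotential_root {r : ℝ}
    (hroot : ∀ x : ℝ, x ^ 2 + μ * x - q ^ 2 = (x - r) * (x + q ^ 2 / r)) :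
    nutPotential c μ q r = 0 := by
  simp [nutPotential, hroot]

theorem nutPotential_sub (hq : q ≠ 0) (x : ℝ) :
    nutPotential c μ q x - c = c * (μ * x - 2 * q ^ 2) / (x ^ 2 + q ^ 2) := by
  have hS : x ^ 2 + q ^ 2 ≠ 0 := by positivity
  rw [nutPotential]
  field_simp
  ring

/-- `nutPotential` tends to `c` at infinity. -/
theorem abs_nutPotential_sub_le (hq : q ≠ 0) (hc : 0 < c) {r : ℝ} (hr : 0 < r) {x : ℝ}
    (hx : r < x) : |nutPotential c μ q x - c| ≤ c * (|μ| + 2 * q ^ 2 / r) / x := by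
  have h2 : 0 < x := hr.trans hx
  have hS : 0 < x ^ 2 + q ^ 2 := by positivity
  rw [nutPotential_sub hq, abs_div, abs_mul, abs_of_pos hc, abs_of_pos hS, div_le_div_iff₀ hS h2,
    mul_assoc, mul_assoc]
  refine mul_le_mul_of_nonneg_left ?_ hc.le
  have h3 : |μ * x - 2 * q ^ 2| ≤ |μ| * x + 2 * q ^ 2 := by
    refine (abs_sub _ _).trans_eq ?_
    rw [abs_mul, abs_of_pos h2, abs_of_nonneg (by positivity : 0 ≤ 2 * q ^ 2)]
  have h4 : 2 * q ^ 2 ≤ 2 * q ^ 2 / r * x := by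
    rw [div_mul_eq_mul_div, le_div_iff₀ hr]
    exact mul_le_mul_of_nonneg_left hx.le (by positivity)
  have h5 : |μ * x - 2 * q ^ 2| ≤ (|μ| + 2 * q ^ 2 / r) * x := by linarith
  have h6 : 0 ≤ |μ| + 2 * q ^ 2 / r := by positivity
  nlinarith [mul_le_mul_of_nonneg_right h5 h2.le, mul_nonneg h6 (sq_nonneg q)]

end Potential

/-! ### Asymptotics -/

section Asymptotics

open Set

/-- A solution of `x' = v(x)` with `v = α + O(1/x)` and `x` growing at least linearly satisfies
`x = α t + O(log t)`. -/
theorem exists_abs_sub_le_log {x v : ℝ → ℝ} {α K δ : ℝ} (hK : 0 ≤ K) (hδ : 0 < δ)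
    (hx : ∀ t, 0 ≤ t → HasDerivAt x (v t) t) (hv : ∀ t, 0 ≤ t → |v t - α| ≤ K / x t)
    (hl : ∀ t, 0 ≤ t → δ * (t + 1) ≤ x t) :
    ∃ C, 0 < C ∧ ∀ t, 2 ≤ t → |x t - α * t| ≤ C * Real.log t := by
  have hlog : ∀ t : ℝ, 0 ≤ t → HasDerivAt (fun t => Real.log (t + 1)) (t + 1)⁻¹ t := by
    intro t ht
    have := ((hasDerivAt_id t).add_const 1).log (by simp; linarith)
    simpa using this
  have hv' : ∀ t, 0 ≤ t → |v t - α| ≤ K / δ * (t + 1)⁻¹ := by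
    intro t ht
    refine (hv t ht).trans ?_
    rw [← div_eq_mul_inv, div_div]
    exact div_le_div_of_nonneg_left hK (by positivity) (hl t ht)
  have hb : ∀ t, 0 ≤ t → |x t - α * t - x 0| ≤ K / δ * Real.log (t + 1) := by
    intro t ht
    have hu : ∀ t, 0 ≤ t → HasDerivAt (fun t => x t - α * t) (v t - α) t := fun t ht => by
      simpa using (hx t ht).fun_sub ((hasDerivAt_id t).const_mul α)
    have h1 : MonotoneOn (fun t => K / δ * Real.log (t + 1) - (x t - α * t)) (Ici 0) := by
      refine monotoneOn_of_hasDerivWithinAt_nonneg (convex_Ici 0)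
        (f' := fun t => K / δ * (t + 1)⁻¹ - (v t - α))
        (HasDerivAt.continuousOn fun t ht => ((hlog t ht).const_mul _).fun_sub (hu t ht))
        (fun t ht => ?_) (fun t ht => ?_)
      · exact (((hlog t (interior_subset ht)).const_mul _).fun_sub
          (hu t (interior_subset ht))).hasDerivWithinAt
      · linarith [(abs_le.1 (hv' t (interior_subset ht))).2]
    have h2 : MonotoneOn (fun t => K / δ * Real.log (t + 1) + (x t - α * t)) (Ici 0) := by
      refine monotoneOn_of_hasDerivWithinAt_nonneg (convex_Ici 0)
        (f' := fun t => K / δ * (t + 1)⁻¹ + (v t - α))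
        (HasDerivAt.continuousOn fun t ht => ((hlog t ht).const_mul _).fun_add (hu t ht))
        (fun t ht => ?_) (fun t ht => ?_)
      · exact (((hlog t (interior_subset ht)).const_mul _).fun_add
          (hu t (interior_subset ht))).hasDerivWithinAt
      · linarith [(abs_le.1 (hv' t (interior_subset ht))).1]
    have h3 := h1 self_mem_Ici ht ht
    have h4 := h2 self_mem_Ici ht ht
    simp only [zero_add, Real.log_one, mul_zero, sub_zero] at h3 h4
    rw [abs_le]
    constructor <;> linarith
  have hl2 : 0 < Real.log 2 := Real.log_pos one_lt_two
  refine ⟨2 * (K / δ) + |x 0| / Real.log 2 + 1, by positivity, fun t ht => ?_⟩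
  have h1 := hb t (by linarith)
  have h2 : Real.log (t + 1) ≤ 2 * Real.log t := by
    rw [← Real.log_rpow (by linarith), Real.rpow_two]
    exact Real.log_le_log (by linarith) (by nlinarith)
  have h3 : Real.log 2 ≤ Real.log t := Real.log_le_log two_pos ht
  have h4 : |x 0| ≤ |x 0| / Real.log 2 * Real.log t := by
    rw [div_mul_eq_mul_div, le_div_iff₀ hl2]
    exact mul_le_mul_of_nonneg_left h3 (abs_nonneg _)
  have h5 : K / δ * Real.log (t + 1) ≤ K / δ * (2 * Real.log t) :=
    mul_le_mul_of_nonneg_left h2 (by positivity)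
  have h6 : |x t - α * t| ≤ |x t - α * t - x 0| + |x 0| := by
    simpa using abs_add_le (x t - α * t - x 0) (x 0)
  linarith

end Asymptotics

/-! ### The Taub-NUT development -/

/-- The metric with scale factors `u, B, B`, where `u² = f(x)`, `p B² = x² + q²` and `x' = ε p u`, is
Ricci flat. -/
theorem diagonalRicci_nut {n : Fin 3 → ℝ} {c μ q p ε x u B : ℝ} (hn : n 1 = n 2) (hq : n 0 = 2 * q)
    (hq0 : q ≠ 0) (hp : p ≠ 0) (hcp : c * p = -(n 0 * n 1)) (hε : ε ^ 2 = 1) (hu0 : u ≠ 0)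
    (hB0 : B ≠ 0) (hu : u ^ 2 = nutPotential c μ q x) (hB : B ^ 2 = (x ^ 2 + q ^ 2) / p)
    {X Y Z : Fin 3 → ℝ} (hX : X = ![u, B, B])
    (hY : Y = ![ε * (p * nutPotentialDeriv c μ q x / 2), ε * (x * u / B), ε * (x * u / B)])
    (hZ : Z 0 = p ^ 2 * nutPotentialDeriv₂ c μ q x * u / 2)
    (hZ1 : Z 1 = (p * u ^ 2 + x * p * nutPotentialDeriv c μ q x / 2) / B - x ^ 2 * u ^ 2 / B ^ 3)
    (hZ2 : Z 2 = Z 1) (α : Option (Fin 3)) : diagonalRicci n X Y Z α = 0 := by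
  have E0 := nutPotential_mul (c := c) (μ := μ) hq0 x
  have E1 := nutPotentialDeriv_mul (c := c) (μ := μ) hq0 x
  have E2 := nutPotentialDeriv₂_mul (c := c) (μ := μ) hq0 x
  rw [← hu] at E0 E1 E2
  generalize nutPotentialDeriv₂ c μ q x = f₂ at *
  generalize nutPotentialDeriv c μ q x = f₁ at *
  have hS : x ^ 2 + q ^ 2 ≠ 0 := by positivity
  set S := x ^ 2 + q ^ 2 with hSdef
  have hBS : S = p * B ^ 2 := by
    rw [hB]
    field_simp
  obtain rfl : p = S / B ^ 2 := by
    rw [hBS]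
    field_simp
  have hS1 : 2 * q * n 1 * B ^ 2 = -(c * S) := by
    field_simp at hcp
    rw [hcp, hq]
    ring
  -- The components along `∂_t`, `e 0` and `e 1`, up to factors. They follow from the relations for
  -- `f` and its first two derivatives, `u²` being `f`, upon elimination of the second derivative and
  -- of `μ`.
  have Rt : S * (f₂ * S + 4 * u ^ 2 + 2 * x * f₁) - 4 * u ^ 2 * x ^ 2 = 0 := by
    linear_combination S * E2 - 2 * x * E1 + 2 * E0 + 2 * c * hSdef
  have R0 : S * (f₂ * S + 2 * x * f₁) + 4 * q ^ 2 * u ^ 2 = 0 := by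
    linear_combination S * E2 - 2 * x * E1 + 2 * E0 + (2 * c - 4 * u ^ 2) * hSdef
  have R1 : (u ^ 2 + x * f₁) * S + 2 * q * n 1 * B ^ 2 - 2 * q ^ 2 * u ^ 2 = 0 := by
    linear_combination x * E1 - E0 + (2 * u ^ 2 - c) * hSdef + hS1
  have hT : diagonalRicci n X Y Z none = 0 := by
    trans -(1 / (2 * B ^ 4)) * (S * (f₂ * S + 4 * u ^ 2 + 2 * x * f₁) - 4 * u ^ 2 * x ^ 2)
    · simp only [diagonalRicci, Option.elim, Fin.sum_univ_three, hX, hZ, hZ1, hZ2]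
      simp
      field_simp
      ring
    · rw [Rt, mul_zero]
  have h0 : diagonalRicci n X Y Z (some 0) = 0 := by
    trans u ^ 2 / (2 * B ^ 4) * (S * (f₂ * S + ε ^ 2 * (2 * x * f₁)) + 4 * q ^ 2 * u ^ 2)
    · simp only [diagonalRicci, Option.elim, Fin.sum_univ_three, hX, hY, hZ]
      simp [← hn, hq]
      field_simp
      ring
    · rw [hε, one_mul, R0, mul_zero]
  have h1 : diagonalRicci n X Y Z (some 1) = 0 := by
    trans 1 / B ^ 2 * ((u ^ 2 + x * f₁) * S + 2 * q * n 1 * B ^ 2 - 2 * q ^ 2 * u ^ 2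
      + (ε ^ 2 - 1) * (x * f₁ * S / 2 + x ^ 2 * u ^ 2))
    · simp only [diagonalRicci, Option.elim, Fin.sum_univ_three, hX, hY, hZ1]
      simp [← hn, hq]
      field_simp
      ring
    · rw [R1, hε, sub_self, zero_mul, add_zero, mul_zero]
  have h2 : diagonalRicci n X Y Z (some 2) = 0 := by
    rw [← h1]
    simp only [diagonalRicci, Option.elim, Fin.sum_univ_three, hX, hY, hZ2]
    simp [← hn]
    ring
  rcases α with _ | i
  · exact hT
  · fin_cases i
    exacts [h0, h1, h2]

/-- The scale factors of the Taub-NUT development in terms of the solution of `x' = p √f(x)`, where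
`ε` is the time orientation. -/
def nutScaleFactors (c μ q p ε : ℝ) (x : ℝ → ℝ) : Fin 3 → ℝ → ℝ :=
  ![fun t => √(nutPotential c μ q (x (ε * t))), fun t => √((x (ε * t) ^ 2 + q ^ 2) / p),
    fun t => √((x (ε * t) ^ 2 + q ^ 2) / p)]

namespace ClassAData.IsCanonicalBasis

variable {D : ClassAData 𝔤} {e : Module.Basis (Fin 3) ℝ 𝔤} {T : BianchiType} {n κ : Fin 3 → ℝ}

open Filter Topology Set

variable {c μ q p ε : ℝ} {x : ℝ → ℝ} {I : Set ℝ}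

/-- The Taub-NUT metric is a development of the data. The assumption `hcp` makes it Ricci flat, and
`hp` and `hμ` normalize the scale factors to `1` at the initial time. -/
theorem isVacuumDevelopment_nutScaleFactors (hcan : D.IsCanonicalBasis e T n κ) (hκ : κ 1 = κ 2)
    (hn : n 1 = n 2) (hq : n 0 = 2 * q) (hq0 : q ≠ 0) (hε : ε = 1 ∨ ε = -1) (hκ1 : κ 1 ≠ 0)
    (hp : p = κ 1 ^ 2 + q ^ 2) (hcp : c * p = -(n 0 * n 1))
    (hμ : c * (κ 1 ^ 2 + μ * (-(ε * κ 1)) - q ^ 2) = p) (hI : IsOpen I) (hI' : I.OrdConnected)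
    (h0 : (0 : ℝ) ∈ I) (hx0 : x 0 = -(ε * κ 1)) (hxs : ContDiffOn ℝ ∞ x I)
    (hf : ∀ t ∈ I, 0 < nutPotential c μ q (x t))
    (hx : ∀ t ∈ I, HasDerivAt x (p * √(nutPotential c μ q (x t))) t) :
    D.IsVacuumDevelopment e {t | ε * t ∈ I} (nutScaleFactors c μ q p ε x) := by
  have hε2 : ε ^ 2 = 1 := by rcases hε with rfl | rfl <;> norm_num
  have hp0 : 0 < p := by rw [hp]; positivity
  have hI2 : IsOpen {t | ε * t ∈ I} := hI.preimage (continuous_const_mul ε)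
  have hw : ∀ t, 0 < (x (ε * t) ^ 2 + q ^ 2) / p := fun t => by positivity
  have hpos : ∀ i, ∀ t ∈ {t | ε * t ∈ I}, 0 < nutScaleFactors c μ q p ε x i t := by
    intro i t ht
    fin_cases i
    · exact Real.sqrt_pos.2 (hf _ ht)
    · exact Real.sqrt_pos.2 (hw t)
    · exact Real.sqrt_pos.2 (hw t)
  set u : ℝ → ℝ := fun t => √(nutPotential c μ q (x (ε * t))) with hu
  set B : ℝ → ℝ := fun t => √((x (ε * t) ^ 2 + q ^ 2) / p) with hB
  have hupos : ∀ t ∈ {t | ε * t ∈ I}, 0 < u t := hpos 0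
  have hBpos : ∀ t, 0 < B t := fun t => Real.sqrt_pos.2 (hw t)
  have hu2 : ∀ t ∈ {t | ε * t ∈ I}, u t ^ 2 = nutPotential c μ q (x (ε * t)) := fun t ht =>
    Real.sq_sqrt (hf _ ht).le
  have hB2 : ∀ t, B t ^ 2 = (x (ε * t) ^ 2 + q ^ 2) / p := fun t => Real.sq_sqrt (hw t).le
  -- first derivatives
  have hxd : ∀ t ∈ {t | ε * t ∈ I}, HasDerivAt (fun t => x (ε * t)) (ε * (p * u t)) t := by
    intro t ht
    have := (hx _ ht).comp t ((hasDerivAt_id t).const_mul ε)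
    convert! this using 1
    simp only [hu, mul_one]
    ring
  have hud : ∀ t ∈ {t | ε * t ∈ I},
      HasDerivAt u (ε * (p * nutPotentialDeriv c μ q (x (ε * t)) / 2)) t := by
    intro t ht
    have := ((hasDerivAt_nutPotential (c := c) (μ := μ) hq0 _).comp t (hxd t ht)).sqrt (hf _ ht).ne'
    convert! this using 1
    have h1 := (hupos t ht).ne'
    change _ = _ / (2 * u t)
    field_simp
  have hBd : ∀ t ∈ {t | ε * t ∈ I}, HasDerivAt B (ε * (x (ε * t) * u t / B t)) t := by
    intro t ht
    have := ((((hxd t ht).fun_pow 2).add_const (q ^ 2)).div_const p).sqrt (hw t).ne'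
    convert! this using 1
    have h1 := (hBpos t).ne'
    change _ = _ / (2 * B t)
    field_simp
    ring
  -- second derivatives
  have hudd : ∀ t ∈ {t | ε * t ∈ I},
      HasDerivAt (fun t => ε * (p * nutPotentialDeriv c μ q (x (ε * t)) / 2))
        (p ^ 2 * nutPotentialDeriv₂ c μ q (x (ε * t)) * u t / 2) t := by
    intro t ht
    have := ((((hasDerivAt_nutPotentialDeriv (c := c) (μ := μ) hq0 _).comp t
      (hxd t ht)).const_mul p).div_const 2).const_mul ε
    convert! this using 1
    linear_combination -(p ^ 2 * nutPotentialDeriv₂ c μ q (x (ε * t)) * u t / 2) * hε2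
  have hBdd : ∀ t ∈ {t | ε * t ∈ I}, HasDerivAt (fun t => ε * (x (ε * t) * u t / B t))
      ((p * u t ^ 2 + x (ε * t) * p * nutPotentialDeriv c μ q (x (ε * t)) / 2) / B t
        - x (ε * t) ^ 2 * u t ^ 2 / B t ^ 3) t := by
    intro t ht
    have := (((hxd t ht).mul (hud t ht)).div (hBd t ht) (hBpos t).ne').const_mul ε
    convert! this using 1
    have h1 := (hBpos t).ne'
    trans ε ^ 2 * ((p * u t ^ 2 + x (ε * t) * p * nutPotentialDeriv c μ q (x (ε * t)) / 2) / B t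
        - x (ε * t) ^ 2 * u t ^ 2 / B t ^ 3)
    · rw [hε2, one_mul]
    · simp only [Pi.mul_apply]
      field_simp
  have had : ∀ i, ∀ t ∈ {t | ε * t ∈ I}, HasDerivAt (nutScaleFactors c μ q p ε x i)
      ((![fun t => ε * (p * nutPotentialDeriv c μ q (x (ε * t)) / 2),
        fun t => ε * (x (ε * t) * u t / B t), fun t => ε * (x (ε * t) * u t / B t)] :
          Fin 3 → ℝ → ℝ) i t) t := by
    intro i t ht
    fin_cases i
    exacts [hud t ht, hBd t ht, hBd t ht]
  have h0' : (0 : ℝ) ∈ {t | ε * t ∈ I} := by simpa using h0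
  have hx0' : x (ε * 0) = -(ε * κ 1) := by rw [mul_zero, hx0]
  have hx02 : x (ε * 0) ^ 2 = κ 1 ^ 2 := by
    rw [hx0']
    linear_combination κ 1 ^ 2 * hε2
  have hf0 : nutPotential c μ q (x (ε * 0)) = 1 := by
    have h1 := nutPotential_mul (c := c) (μ := μ) hq0 (x (ε * 0))
    rw [hx02, ← hp, hx0', hμ] at h1
    rw [hx0']
    exact mul_right_cancel₀ hp0.ne' (h1.trans (one_mul p).symm)
  have hu0 : u 0 = 1 := by simp only [hu, hf0, Real.sqrt_one]
  have hB0 : B 0 = 1 := by simp only [hB, hx02, ← hp, div_self hp0.ne', Real.sqrt_one]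
  have ha0 : ∀ i, nutScaleFactors c μ q p ε x i 0 = 1 := by
    intro i
    fin_cases i
    exacts [hu0, hB0, hB0]
  -- the Hamiltonian constraint gives the initial velocity of the first scale factor
  have hham : 2 * κ 0 * κ 1 = c * p + q ^ 2 - κ 1 ^ 2 := by
    have := hcan.hamiltonian_eq
    simp only [Fin.sum_univ_three, ← hn, ← hκ] at this
    rw [hcp]
    have hq' : q = n 0 / 2 := by linarith
    rw [hq']
    linear_combination (1 / 2) * this
  have hu'0 : ε * (p * nutPotentialDeriv c μ q (-(ε * κ 1)) / 2) = -κ 0 := by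
    have h1 := nutPotentialDeriv_mul (c := c) (μ := μ) hq0 (x (ε * 0))
    rw [hf0, hx02, ← hp, hx0'] at h1
    apply mul_right_cancel₀ hκ1
    linear_combination (ε * κ 1 / 2) * h1 + (1 - c) * κ 1 ^ 2 * hε2 + (1 / 2) * hham
      - (1 / 2) * hμ + ((c - 1) / 2) * hp
  refine ⟨hI2, ?_, h0', ?_, hpos, ?_, ?_, ?_⟩
  · rcases hε with rfl | rfl
    · simpa using hI'
    · exact hI'.preimage_anti (f := fun t : ℝ => -1 * t) fun s t hst => by simpa using hst
  · have h1 : ContDiffOn ℝ ∞ (fun t => x (ε * t)) {t | ε * t ∈ I} :=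
      hxs.comp (by fun_prop) fun t ht => ht
    have h2 : ContDiffOn ℝ ∞ u {t | ε * t ∈ I} :=
      ((contDiff_nutPotential hq0).comp_contDiffOn h1).sqrt fun t ht => (hf _ ht).ne'
    have h3 : ContDiffOn ℝ ∞ B {t | ε * t ∈ I} :=
      (((h1.pow 2).add contDiffOn_const).div_const p).sqrt fun t ht => (hw t).ne'
    intro i
    fin_cases i
    exacts [h2, h3, h3]
  · intro t ht α β
    rw [spacetimeRicci_diagonalMetric hcan.structureConstants_eq
      (b := ![fun t => ε * (p * nutPotentialDeriv c μ q (x (ε * t)) / 2),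
        fun t => ε * (x (ε * t) * u t / B t), fun t => ε * (x (ε * t) * u t / B t)])
      (z := ![p ^ 2 * nutPotentialDeriv₂ c μ q (x (ε * t)) * u t / 2,
        (p * u t ^ 2 + x (ε * t) * p * nutPotentialDeriv c μ q (x (ε * t)) / 2) / B t
          - x (ε * t) ^ 2 * u t ^ 2 / B t ^ 3,
        (p * u t ^ 2 + x (ε * t) * p * nutPotentialDeriv c μ q (x (ε * t)) / 2) / B t
          - x (ε * t) ^ 2 * u t ^ 2 / B t ^ 3])
      (fun i => by filter_upwards [hI2.mem_nhds ht] with s hs using had i s hs)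
      (fun i => by
        fin_cases i
        exacts [hudd t ht, hBdd t ht, hBdd t ht]) (fun i => (hpos i t ht).ne')]
    split_ifs
    · refine diagonalRicci_nut hn hq hq0 hp0.ne' hcp hε2 (hupos t ht).ne' (hBpos t).ne' (hu2 t ht)
        (hB2 t) (funext fun i => ?_) (funext fun i => ?_) rfl rfl rfl α
      · fin_cases i <;> rfl
      · fin_cases i <;> rfl
    · rfl
  · intro X Y
    simp only [diagonalMetric, ha0]
    conv_rhs => rw [← e.sum_repr X, ← e.sum_repr Y]
    simp [-Module.Basis.sum_repr, hcan.orthonormal]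
    exact Finset.sum_congr rfl fun i _ => mul_comm _ _
  · intro i j
    rw [secondFundamentalForm_diagonalMetric fun i => had i 0 h0', hcan.diagonal, ha0]
    refine if_congr Iff.rfl ?_ rfl
    fin_cases i
    · simp [hx0, hu0, hu'0]
    · simp [hx0, hu0, hB0]
      linear_combination κ 1 * hε2
    · simp [hx0, hu0, hB0]
      linear_combination κ 1 * hε2 + hκ

end ClassAData.IsCanonicalBasis

/-- The scale factors approach their asymptotic values along a solution of `x' = p √f(x)` that
starts beyond the root `r` of `f`. -/
theorem nutScaleFactors_asymptotics {c μ q p ε r : ℝ} {x : ℝ → ℝ} (hq : q ≠ 0) (hc : 0 < c)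
    (hp : 0 < p) (hε : ε ^ 2 = 1) (hr : 0 < r)
    (hroot : ∀ x : ℝ, x ^ 2 + μ * x - q ^ 2 = (x - r) * (x + q ^ 2 / r)) (hx0 : r < x 0)
    (hxr : ∀ t, 0 ≤ t → r < x t)
    (hx : ∀ t, 0 ≤ t → HasDerivAt x (p * √(nutPotential c μ q (x t))) t) :
    ∃ α₁ α₂ T C : ℝ, 0 < α₁ ∧ 0 < α₂ ∧ 0 < T ∧ 0 < C ∧ ∀ t : ℝ, T ≤ t →
      |nutScaleFactors c μ q p ε x 0 (ε * t) - α₁| ≤ C * t⁻¹ ∧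
      nutScaleFactors c μ q p ε x 1 (ε * t) = nutScaleFactors c μ q p ε x 2 (ε * t) ∧
      ∃ δ : ℝ, |δ| ≤ C * (Real.log t / t) ∧
        nutScaleFactors c μ q p ε x 1 (ε * t) = α₂ * t * (1 + δ) := by
  have hpos : ∀ y, r < y → 0 < nutPotential c μ q y := fun y hy =>
    nutPotential_pos hq hc hr hroot hy
  -- monotonicity keeps `x` away from the root, which gives linear growth
  have hmono : MonotoneOn x (Set.Ici 0) := by
    refine monotoneOn_of_hasDerivWithinAt_nonneg (convex_Ici 0) (HasDerivAt.continuousOn hx)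
      (fun t ht => (hx t (interior_subset ht)).hasDerivWithinAt) fun t ht => by positivity
  have hxh : ∀ t, 0 ≤ t → x 0 ≤ x t := fun t ht => hmono Set.self_mem_Ici ht ht
  set h := x 0
  have hh : 0 < h := hr.trans hx0
  set m := c * (1 - r / h) / (1 + q ^ 2 / h ^ 2) with hm
  have hm0 : 0 < m := by
    have : 0 < 1 - r / h := sub_pos.2 ((div_lt_one hh).2 hx0)
    positivity
  have hfm : ∀ y, h ≤ y → m ≤ nutPotential c μ q y := by
    intro y hy
    have hy0 : 0 < y := hh.trans_le hy
    have h1 : 1 - r / h ≤ 1 - r / y :=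
      sub_le_sub_left (div_le_div_of_nonneg_left hr.le hh hy) 1
    have h2 : 1 + q ^ 2 / y ^ 2 ≤ 1 + q ^ 2 / h ^ 2 := by gcongr
    have h3 : 0 ≤ 1 - r / y := by
      rw [sub_nonneg, div_le_one hy0]
      exact hx0.le.trans hy
    have h4 : nutPotential c μ q y
        = c * ((1 - r / y) * (1 + q ^ 2 / r / y)) / (1 + q ^ 2 / y ^ 2) := by
      rw [nutPotential, hroot]
      field_simp
    rw [hm, h4]
    have h5 : 1 - r / y ≤ (1 - r / y) * (1 + q ^ 2 / r / y) :=
      le_mul_of_one_le_right h3 (le_add_of_nonneg_right (by positivity))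
    gcongr
    exact h1.trans h5
  have hgrow : ∀ t, 0 ≤ t → h + p * √m * t ≤ x t := by
    intro t ht
    have h1 : MonotoneOn (fun t => x t - p * √m * t) (Set.Ici 0) := by
      have hd : ∀ t ∈ Set.Ici (0 : ℝ), HasDerivAt (fun t => x t - p * √m * t)
          (p * √(nutPotential c μ q (x t)) - p * √m) t := fun t ht => by
        simpa using (hx t ht).fun_sub ((hasDerivAt_id t).const_mul (p * √m))
      refine monotoneOn_of_hasDerivWithinAt_nonneg (convex_Ici 0) (HasDerivAt.continuousOn hd)
        (fun t ht => (hd t (interior_subset ht)).hasDerivWithinAt) fun t ht => ?_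
      have := Real.sqrt_le_sqrt (hfm _ (hxh t (interior_subset ht)))
      exact sub_nonneg.2 (mul_le_mul_of_nonneg_left this hp.le)
    have h2 := h1 Set.self_mem_Ici ht ht
    simp only [mul_zero, sub_zero] at h2
    linarith
  set δ := min h (p * √m) with hδ
  have hδ0 : 0 < δ := lt_min hh (by positivity)
  have hlin : ∀ t, 0 ≤ t → δ * (t + 1) ≤ x t := by
    intro t ht
    have h1 : δ * t ≤ p * √m * t := mul_le_mul_of_nonneg_right (min_le_right _ _) ht
    linarith [hgrow t ht, min_le_left h (p * √m)]
  -- the first scale factor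
  set K := c * (|μ| + 2 * q ^ 2 / r) / √c with hK
  have hK0 : 0 ≤ K := by positivity
  have hsc : 0 < √c := Real.sqrt_pos.2 hc
  have hsqrt : ∀ t, 0 ≤ t → |√(nutPotential c μ q (x t)) - √c| ≤ K / x t := by
    intro t ht
    have h1 := abs_nutPotential_sub_le hq hc hr (μ := μ) (hxr t ht)
    have h2 : 0 ≤ √(nutPotential c μ q (x t)) := Real.sqrt_nonneg _
    have h3 : nutPotential c μ q (x t) - c =
        (√(nutPotential c μ q (x t)) - √c) * (√(nutPotential c μ q (x t)) + √c) := by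
      linear_combination Real.sq_sqrt hc.le - Real.sq_sqrt (hpos _ (hxr t ht)).le
    rw [h3, abs_mul, abs_of_pos (add_pos_of_nonneg_of_pos h2 hsc)] at h1
    rw [hK, div_div, mul_comm √c, ← div_div, le_div_iff₀ hsc]
    refine le_trans ?_ h1
    exact mul_le_mul_of_nonneg_left (le_add_of_nonneg_left h2) (abs_nonneg _)
  -- the other two
  obtain ⟨C₁, hC₁, hxC⟩ := exists_abs_sub_le_log (α := p * √c) (mul_nonneg hp.le hK0) hδ0 hx
    (fun t ht => by
      rw [← mul_sub, abs_mul, abs_of_pos hp, mul_div_assoc]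
      exact mul_le_mul_of_nonneg_left (hsqrt t ht) hp.le) hlin
  have hl2 : 0 < Real.log 2 := Real.log_pos one_lt_two
  set C₂ := C₁ + |q| / Real.log 2 with hC₂
  have hC₂0 : 0 < C₂ := add_pos_of_pos_of_nonneg hC₁ (div_nonneg (abs_nonneg q) hl2.le)
  have hεt : ∀ t, ε * (ε * t) = t := fun t => by linear_combination t * hε
  refine ⟨√c, p * √c / √p, 2, K / δ + C₂ / (p * √c) + 1, hsc, by positivity, two_pos, by positivity,
    fun t ht => ⟨?_, rfl, ?_⟩⟩
  · have ht0 : 0 < t := by linarith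
    have h1 : |√(nutPotential c μ q (x t)) - √c| ≤ K / δ * t⁻¹ := by
      refine (hsqrt t ht0.le).trans ?_
      rw [← div_eq_mul_inv, div_div K δ t]
      refine div_le_div_of_nonneg_left hK0 (mul_pos hδ0 ht0) (le_trans ?_ (hlin t ht0.le))
      exact mul_le_mul_of_nonneg_left (by linarith) hδ0.le
    have h2 : nutScaleFactors c μ q p ε x 0 (ε * t) = √(nutPotential c μ q (x t)) := by
      simp [nutScaleFactors, hεt]
    rw [h2]
    refine h1.trans (mul_le_mul_of_nonneg_right ?_ (by positivity))
    have : 0 ≤ C₂ / (p * √c) := by positivity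
    linarith
  · have ht0 : 0 < t := by linarith
    have h2 : nutScaleFactors c μ q p ε x 1 (ε * t) = √(x t ^ 2 + q ^ 2) / √p := by
      simp [nutScaleFactors, hεt, Real.sqrt_div' _ hp.le]
    have hxt : 0 < x t := hr.trans (hxr t ht0.le)
    have h3 : x t ≤ √(x t ^ 2 + q ^ 2) := Real.le_sqrt_of_sq_le (by nlinarith)
    have h4 : √(x t ^ 2 + q ^ 2) ≤ x t + |q| := by
      refine Real.sqrt_le_iff.2 ⟨by positivity, ?_⟩
      nlinarith [sq_abs q, mul_nonneg hxt.le (abs_nonneg q)]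
    have h5 : |√(x t ^ 2 + q ^ 2) - p * √c * t| ≤ C₂ * Real.log t := by
      have h6 := hxC t ht
      have h7 : |q| ≤ |q| / Real.log 2 * Real.log t := by
        rw [div_mul_eq_mul_div, le_div_iff₀ hl2]
        exact mul_le_mul_of_nonneg_left (Real.log_le_log two_pos ht) (abs_nonneg _)
      have h8 : |√(x t ^ 2 + q ^ 2) - x t| ≤ |q| := by
        rw [abs_le]
        constructor <;> linarith [abs_nonneg q]
      have h9 := abs_sub_le √(x t ^ 2 + q ^ 2) (x t) (p * √c * t)
      rw [hC₂, add_mul]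
      linarith
    refine ⟨(√(x t ^ 2 + q ^ 2) - p * √c * t) / (p * √c * t), ?_, ?_⟩
    · rw [abs_div, abs_of_pos (by positivity : 0 < p * √c * t)]
      have hlt : 0 < Real.log t := Real.log_pos (by linarith)
      have h6 : C₂ * Real.log t / (p * √c * t) = C₂ / (p * √c) * (Real.log t / t) := by
        field_simp
      refine (div_le_div_of_nonneg_right h5 (by positivity)).trans ?_
      rw [h6]
      refine mul_le_mul_of_nonneg_right ?_ (by positivity)
      have : 0 ≤ K / δ := by positivity
      linarith
    · rw [h2]
      field_simp
      ring

namespace ClassAData.IsCanonicalBasis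

variable {D : ClassAData 𝔤} {e : Module.Basis (Fin 3) ℝ 𝔤} {n κ : Fin 3 → ℝ}

open Filter Topology Set

/-- The maximal development of NUT data is the Taub-NUT solution. It ends where the first scale
factor tends to zero. -/
theorem exists_nut_development (hcan : D.IsCanonicalBasis e .VIII n κ) (hκ : κ 1 = κ 2)
    (hn : n 1 = n 2) : ∃ (I : Set ℝ) (a : Fin 3 → ℝ → ℝ), D.IsVacuumDevelopment e I a ∧
      (∀ J b, D.IsVacuumDevelopment e J b → J ⊆ I) ∧
      ∃ ε : ℝ, (ε = 1 ∨ ε = -1) ∧ ε * metricTrace e D.g D.k < 0 ∧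
        (∀ t : ℝ, 0 ≤ t → ε * t ∈ I) ∧
        ∃ α₁ α₂ T C : ℝ, 0 < α₁ ∧ 0 < α₂ ∧ 0 < T ∧ 0 < C ∧ ∀ t : ℝ, T ≤ t →
          |a 0 (ε * t) - α₁| ≤ C * t⁻¹ ∧ a 1 (ε * t) = a 2 (ε * t) ∧
          ∃ δ : ℝ, |δ| ≤ C * (Real.log t / t) ∧ a 1 (ε * t) = α₂ * t * (1 + δ) := by
  have hn0 : n 0 < 0 := by simpa [BianchiType.signs, sign_eq_neg_one_iff] using hcan.signs 0
  have hn1 : 0 < n 1 := by simpa [BianchiType.signs, sign_eq_one_iff] using hcan.signs 1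
  have hnn : n 0 * n 1 < 0 := mul_neg_of_neg_of_pos hn0 hn1
  -- the constraint says that the scalar curvature is negative, so that `k` is not trace free
  have hham : κ 1 * (κ 1 + 2 * κ 0) = n 0 ^ 2 / 4 - n 0 * n 1 := by
    have := hcan.hamiltonian_eq
    simp only [Fin.sum_univ_three, ← hn, ← hκ] at this
    linarith
  have hham0 : 0 < κ 1 * (κ 1 + 2 * κ 0) := by
    rw [hham]
    nlinarith [sq_nonneg (n 0)]
  have hκ1 : κ 1 ≠ 0 := left_ne_zero_of_mul hham0.ne'
  obtain ⟨ε, hε, hεκ⟩ : ∃ ε : ℝ, (ε = 1 ∨ ε = -1) ∧ 0 < -(ε * κ 1) := by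
    rcases hκ1.lt_or_gt with h | h
    · exact ⟨1, Or.inl rfl, by linarith⟩
    · exact ⟨-1, Or.inr rfl, by linarith⟩
  have hε2 : ε ^ 2 = 1 := by rcases hε with rfl | rfl <;> norm_num
  have htr : ε * metricTrace e D.g D.k < 0 := by
    rw [hcan.metricTrace_eq, Fin.sum_univ_three, ← hκ]
    have h1 : 0 < -(ε * (κ 1 + 2 * κ 0)) := by
      refine pos_of_mul_pos_right ?_ hεκ.le
      calc 0 < κ 1 * (κ 1 + 2 * κ 0) := hham0
        _ = -(ε * κ 1) * -(ε * (κ 1 + 2 * κ 0)) := by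
          linear_combination -(κ 1 * (κ 1 + 2 * κ 0)) * hε2
    linarith
  set q := n 0 / 2 with hqdef
  have hq : n 0 = 2 * q := by rw [hqdef]; ring
  have hq0 : q ≠ 0 := by rw [hqdef]; exact (div_neg_of_neg_of_pos hn0 two_pos).ne
  set p := κ 1 ^ 2 + q ^ 2 with hp
  have hp0 : 0 < p := by positivity
  set c := -(n 0 * n 1) / p with hc
  have hc0 : 0 < c := div_pos (neg_pos.2 hnn) hp0
  have hcp : c * p = -(n 0 * n 1) := div_mul_cancel₀ _ hp0.ne'
  -- this `μ` makes the potential equal to `1` at the initial value of `x`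
  set μ := (p / c - κ 1 ^ 2 + q ^ 2) / (-(ε * κ 1)) with hμdef
  have hμ : c * (κ 1 ^ 2 + μ * (-(ε * κ 1)) - q ^ 2) = p := by
    rw [hμdef, div_mul_cancel₀ _ hεκ.ne']
    field_simp
    ring
  obtain ⟨r, hr, hroot⟩ := exists_root hq0 μ
  have hpos : ∀ y, r < y → 0 < nutPotential c μ q y := fun y hy =>
    nutPotential_pos hq0 hc0 hr hroot hy
  have hrh : r < -(ε * κ 1) := by
    have h1 : 0 < (-(ε * κ 1) - r) * (-(ε * κ 1) + q ^ 2 / r) := by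
      rw [← hroot]
      refine pos_of_mul_pos_right (?_ : 0 < c * _) hc0.le
      rw [show c * ((-(ε * κ 1)) ^ 2 + μ * (-(ε * κ 1)) - q ^ 2) = p by
        linear_combination hμ + c * κ 1 ^ 2 * hε2]
      exact hp0
    exact sub_pos.1 (pos_of_mul_pos_left h1 (by positivity))
  obtain ⟨I, x, hI, hI', hIci, hx0, hxr, hx, hxs, hend⟩ :=
    exists_solution_of_autonomous (F := fun y => p * √(nutPotential c μ q y))
      (M := p * √(c + c * (|μ| + 2 * q ^ 2 / r) / r)) hrh
      (contDiffOn_const.mul ((contDiff_nutPotential hq0).contDiffOn.sqrt fun y hy =>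
        (hpos y hy).ne'))
      (fun y hy => mul_pos hp0 (Real.sqrt_pos.2 (hpos y hy)))
      (fun y hy => by
        have h1 := (abs_le.1 (abs_nutPotential_sub_le hq0 hc0 hr (μ := μ) hy)).2
        have h2 : c * (|μ| + 2 * q ^ 2 / r) / y ≤ c * (|μ| + 2 * q ^ 2 / r) / r :=
          div_le_div_of_nonneg_left (by positivity) hr (le_of_lt hy)
        exact mul_le_mul_of_nonneg_left (Real.sqrt_le_sqrt (by linarith)) hp0.le)
  have hdev := hcan.isVacuumDevelopment_nutScaleFactors hκ hn hq hq0 hε hκ1 hp hcp hμ hI hI'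
    (hIci self_mem_Ici) hx0 hxs (fun t ht => hpos _ (hxr t ht)) hx
  have hεt : ∀ t, ε * (ε * t) = t := fun t => by linear_combination t * hε2
  refine ⟨_, _, hdev, fun J b hJ t ht => ?_, ε, hε, htr, fun t ht => ?_,
    nutScaleFactors_asymptotics hq0 hc0 hp0 hε2 hr hroot (hx0 ▸ hrh) (fun t ht => hxr t (hIci ht))
      fun t ht => hx t (hIci ht)⟩
  · -- otherwise `b 0` would vanish at the end of the maximal interval
    by_contra htI
    obtain ⟨t₀, ht₀, ht₀', hsub, hlim⟩ := hend _ htI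
    have hJ' : {s | ε * s ∈ J}.OrdConnected := by
      rcases hε with rfl | rfl
      · simpa using hJ.ordConnected
      · exact hJ.ordConnected.preimage_anti (f := fun t : ℝ => -1 * t) fun s t hst => by
          simpa using hst
    have ht₀J : ε * t₀ ∈ J := hJ'.out (show ε * (ε * t) ∈ J by rwa [hεt])
      (show ε * 0 ∈ J by simpa using hJ.zero_mem) ⟨ht₀, ht₀'.le⟩
    have hcont : Tendsto (fun s => b 0 (ε * s)) (𝓝[>] t₀) (𝓝 (b 0 (ε * t₀))) :=
      ((hJ.hasDerivAt ht₀J 0).continuousAt.tendsto.comp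
        (continuous_const_mul ε).continuousAt.tendsto).mono_left nhdsWithin_le_nhds
    have hzero : Tendsto (fun s => b 0 (ε * s)) (𝓝[>] t₀) (𝓝 0) := by
      have h1 : Tendsto (fun s => √(nutPotential c μ q (x s))) (𝓝[>] t₀) (𝓝 0) := by
        have h2 := ((contDiff_nutPotential (c := c) (μ := μ) hq0).continuous.sqrt.tendsto r).comp hlim
        rwa [nutPotential_root hroot, Real.sqrt_zero] at h2
      refine h1.congr' ?_
      have hJo : ∀ᶠ s in 𝓝[>] t₀, ε * s ∈ J :=
        nhdsWithin_le_nhds ((continuous_const_mul ε).continuousAt.eventually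
          (hJ.isOpen.mem_nhds ht₀J))
      filter_upwards [hJo, self_mem_nhdsWithin] with s hs hs'
      have h3 : ε * (ε * s) ∈ I := by
        rw [hεt]
        exact hsub hs'
      rw [← hdev.eq_of_mem hcan hJ h3 hs 0]
      simp [nutScaleFactors, hεt]
    exact (hJ.pos 0 _ ht₀J).ne' (tendsto_nhds_unique hcont hzero)
  · change ε * (ε * t) ∈ I
    rw [hεt]
    exact hIci ht

end ClassAData.IsCanonicalBasis

end

theorem mainTheorem3 {G : Type*} [TopologicalSpace G]
    [ChartedSpace (EuclideanSpace ℝ (Fin 3)) G] [Group G]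
    [LieGroup 𝓘(ℝ, EuclideanSpace ℝ (Fin 3)) (minSmoothness ℝ 3) G]
    (D : ClassAData (GroupLieAlgebra 𝓘(ℝ, EuclideanSpace ℝ (Fin 3)) G)) (hD : D.IsNUT) :
    (∃ I gbar, D.IsClassADevelopment I gbar) ∧
    ∀ I gbar, D.IsClassADevelopment I gbar →
      ∃ (e : Module.Basis (Fin 3) ℝ (GroupLieAlgebra 𝓘(ℝ, EuclideanSpace ℝ (Fin 3)) G))
        (a : Fin 3 → ℝ → ℝ),
        D.IsNUTBasis e ∧
        (∀ i, ∀ t ∈ I, 0 < a i t) ∧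
        (∀ t ∈ I, gbar t = diagonalMetric e a t) ∧
        -- `ε` is the choice of the time orientation in which the initial hypersurface expands
        ∃ ε : ℝ, (ε = 1 ∨ ε = -1) ∧ ε * metricTrace e D.g D.k < 0 ∧
          (∀ t : ℝ, 0 ≤ t → ε * t ∈ I) ∧
          ∃ α₁ α₂ T C : ℝ, 0 < α₁ ∧ 0 < α₂ ∧ 0 < T ∧ 0 < C ∧
            ∀ t : ℝ, T ≤ t →
              |a 0 (ε * t) - α₁| ≤ C * t⁻¹ ∧
              a 1 (ε * t) = a 2 (ε * t) ∧
              ∃ δ : ℝ, |δ| ≤ C * (Real.log t / t) ∧ a 1 (ε * t) = α₂ * t * (1 + δ) := by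
  obtain ⟨e, n, κ, hcan, hκ, hn⟩ := hD
  refine ⟨?_, ?_⟩
  · obtain ⟨I, a, hdev, hmax, -⟩ := hcan.exists_nut_development hκ hn
    exact ⟨I, diagonalMetric e a, e, .VIII, n, κ, a, hcan, hdev, hmax, fun _ _ => rfl⟩
  · rintro I gbar ⟨e', T', n', κ', a', hcan', hdev', hmax', hgbar⟩
    obtain ⟨rfl, hκ', hn'⟩ := hcan.isNUTBasis hκ hn hcan'
    obtain ⟨I₀, a, hdev, -, ε, hε, htr, hI₀, α₁, α₂, T, C, h1, h2, hT, hC, has⟩ :=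
      hcan'.exists_nut_development hκ' hn'
    refine ⟨e', a', ⟨n', κ', hcan', hκ', hn'⟩, hdev'.pos, hgbar, ε, hε, htr,
      fun t ht => hmax' _ _ hdev (hI₀ t ht), α₁, α₂, T, C, h1, h2, hT, hC, fun t ht => ?_⟩
    have ht₀ := hI₀ t (hT.le.trans ht)
    have heq : ∀ i, a' i (ε * t) = a i (ε * t) := fun i =>
      hdev'.eq_of_mem hcan' hdev (hmax' _ _ hdev ht₀) ht₀ i
    simp only [heq]
    exact has t ht
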